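/- Let $\mathcal A$ be a finite alphabet and let $\Omega=\mathcal A^{\mathbb N}$, $\mathbb N=\{1,2,\dots\}$, carry the $\sigma$-algebra generated by the cylinders $[a]=\{x: x_1^n=a\}$, $a\in\mathcal A^n$, where $x_i^j=x_ix_{i+1}\cdots x_j$. Let $T$ be the shift, $(Tx)_k=x_{k+1}$. For a $T$-invariant probability measure $\mathbb P$ on $\Omega$ put $\operatorname{supp}\mathbb P_n=\{a\in\mathcal A^n:\mathbb P[a]>0\}$, and for $a\in\mathcal A^\ell$ and $x\in\Omega$ put $W_\ell(a,x)=\inf\{r\in\mathbb N: x_r^{r+\ell-1}=a\}\in\mathbb N\cup\{\infty\}$. Consider the following conditions. (ID) There is a nondecreasing real sequence $(k_n)_{n\ge1}$ with $k_n=o(n)$ such that for all $n,m\in\mathbb N$, $a\in\operatorname{supp}\mathbb P_n$ and $b\in\operatorname{supp}\mathbb P_m$ we have $$\frac{\mathbb P[ab]}{\mathbb P[a]\,\mathbb P[b]}\le e^{k_n},\qquad\text{and, if } ab\in\operatorname{supp}\mathbb P_{n+m},\qquad \frac{\mathbb P[ab]}{\mathbb P[a]\,\mathbb P[b]}\ge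 e^{-k_n}.$$ (FE) There is $\gamma_+<0$ such that, for all $n$ large enough, $\mathbb P[a]\le e^{\gamma_+n}$ for all $a\in\operatorname{supp}\mathbb P_n$. (KB) There are real sequences $(k_n)_{n\ge1}$ and $(\tau_n)_{n\ge1}$, both $o(n)$, with $n+\tau_n>0$ for all $n$, such that for all $\ell\in\mathbb N$, $a\in\mathcal A^\ell$ and $r\in\mathbb N$, $$\mathbb P\{x: W_\ell(a,x)\ge r\}\le\exp\left(-e^{-k_\ell}\,\mathbb P[a]\left\lfloor\frac{r-1}{\ell+\tau_\ell}\right\rfloor\right).$$ For $x,y\in\Omega$ let $c_N(y|x)$ be the number of words in the sequential parsing of $y_1^N$ in which each word is the longest prefix of the part of $y_1^N$ not yet parsed that is a substring of $x_1^N$, or one letter if no nonempty prefix is such a substring. The specific cross entropy of $\mathbb Q$ with respect to $\mathbb P$ is $$h_{\mathrm c}(\mathbb Q|\mathbb P)=\lim_{n\to\infty}-\frac1n\sum_{a\in\mathcal A^n}\mathbb Q[a]\ln\mathbb P[a]$$ (with $-\ln 0=\infty$ and $0\cdot\infty=0$) when this limit exists in $[0,\infty]$. **Theorem.** Suppose that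 the $T$-invariant probability measure $\mathbb P$ satisfies (ID), (FE) and (KB), and that the ergodic $T$-invariant probability measure $\mathbb Q$ satisfies (ID) and (FE). Then $h_{\mathrm c}(\mathbb Q|\mathbb P)$ exists in $[0,\infty]$, and $$\lim_{N\to\infty}\frac{c_N(y|x)\,\ln N}{N}=h_{\mathrm c}(\mathbb Q|\mathbb P)$$ for $\mathbb P\otimes\mathbb Q$-almost every pair $(x,y)\in\Omega\times\Omega$. -/

import Mathlib

open MeasureTheory Filter Topology Asymptotics
open scoped ENNReal

namespace ZivMerhav

noncomputable section

variable {A : Type*}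

/-- The left shift on sequences. The letter `x_k`, `k = 1, 2, …`, is `x (k - 1)`. -/
def shift (x : ℕ → A) : ℕ → A := fun k => x (k + 1)

/-- The cylinder `[a]` of all sequences that start with the word `a` of length `n`. -/
def cyl {n : ℕ} (a : Fin n → A) : Set (ℕ → A) := {x | ∀ i : Fin n, x i = a i}

/-- The words of length `n` of positive probability. -/
def suppWords [MeasurableSpace A] (P : Measure (ℕ → A)) (n : ℕ) : Set (Fin n → A) :=
  {a | 0 < P (cyl a)}

/-- `n⁻¹ ∑ Q[a] (- ln P[a])`, the sum being over all words `a` of length `n`, as an element of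
`[0, ∞]`, with `- ln 0 = ∞` and `0 · ∞ = 0`. -/
def crossEntropySeq [Fintype A] [MeasurableSpace A] (Q P : Measure (ℕ → A)) (n : ℕ) : ℝ≥0∞ :=
  (∑ a : Fin n → A, Q (cyl a) * (-(ENNReal.log (P (cyl a)))).toENNReal) / (n : ℝ≥0∞)

/-- The specific cross entropy of `Q` with respect to `P` exists in `[0, ∞]` and equals `h`. -/
def IsCrossEntropy [Fintype A] [MeasurableSpace A] (Q P : Measure (ℕ → A)) (h : ℝ≥0∞) : Prop :=
  Tendsto (crossEntropySeq Q P) atTop (𝓝 h)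

/-- The waiting time `W_ℓ(a, x)`: the smallest `r ≥ 1` (here `r = i + 1`) such that the word `a`
occurs in `x` starting at the `r`-th letter; it is `∞` if there is none. -/
def waitingTime {l : ℕ} (a : Fin l → A) (x : ℕ → A) : ℕ∞ :=
  ⨅ (i : ℕ) (_ : ∀ j : Fin l, x (i + j) = a j), ((i + 1 : ℕ) : ℕ∞)

/-- Immediate decoupling on the support. -/
def ImmediatelyDecoupled [MeasurableSpace A] (P : Measure (ℕ → A)) : Prop :=
  ∃ k : ℕ → ℝ, Monotone k ∧ k =o[atTop] (fun n : ℕ => (n : ℝ)) ∧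
    ∀ n m : ℕ, 1 ≤ n → 1 ≤ m → ∀ a ∈ suppWords P n, ∀ b ∈ suppWords P m,
      P.real (cyl (Fin.append a b)) / (P.real (cyl a) * P.real (cyl b)) ≤ Real.exp (k n) ∧
      (Fin.append a b ∈ suppWords P (n + m) →
        Real.exp (-(k n)) ≤ P.real (cyl (Fin.append a b)) / (P.real (cyl a) * P.real (cyl b)))

/-- Fast enough decay of the measure of cylinders. -/
def FastDecay [MeasurableSpace A] (P : Measure (ℕ → A)) : Prop :=
  ∃ γ : ℝ, γ < 0 ∧ ∀ᶠ n : ℕ in atTop, ∀ a ∈ suppWords P n, P.real (cyl a) ≤ Real.exp (γ * n)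

/-- Kontoyiannis' bound on waiting times. -/
def KontoyiannisBound [MeasurableSpace A] (P : Measure (ℕ → A)) : Prop :=
  ∃ k τ : ℕ → ℝ, k =o[atTop] (fun n : ℕ => (n : ℝ)) ∧ τ =o[atTop] (fun n : ℕ => (n : ℝ)) ∧
    (∀ l : ℕ, 1 ≤ l → 0 < (l : ℝ) + τ l) ∧
    ∀ l : ℕ, 1 ≤ l → ∀ a : Fin l → A, ∀ r : ℕ, 1 ≤ r →
      P.real {x | (r : ℕ∞) ≤ waitingTime a x} ≤
        Real.exp (-(Real.exp (-(k l)) * P.real (cyl a) * (⌊((r : ℝ) - 1) / (l + τ l)⌋ : ℝ)))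

/-- The `l` letters of `y` that follow its first `i` letters form a substring of the word made of
the first `N` letters of `x`. -/
def OccursIn (x y : ℕ → A) (N i l : ℕ) : Prop :=
  ∃ r : ℕ, r + l ≤ N ∧ ∀ j < l, x (r + j) = y (i + j)

open Classical in
/-- The length of the next parsed word once the first `i < N` letters of `y` have been parsed: the
longest prefix of the remaining letters of `y` (up to the `N`-th) that is a substring of the first
`N` letters of `x`, or a single letter if there is no nonempty such prefix. -/
def wordLength (x y : ℕ → A) (N i : ℕ) : ℕ :=
  max 1 (Nat.findGreatest (OccursIn x y N i) (N - i))

/-- The number of letters of `y` used by the first `j` parsed words. -/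
def parsedLength (x y : ℕ → A) (N : ℕ) : ℕ → ℕ
  | 0 => 0
  | j + 1 => parsedLength x y N j + wordLength x y N (parsedLength x y N j)

/-- `c_N(y|x)`: the number of words in the sequential parsing of the first `N` letters of `y` with
respect to the first `N` letters of `x`, i.e. the number of words after which all `N` letters are
used up. -/
def parsingCount (y x : ℕ → A) (N : ℕ) : ℕ := sInf {j | N ≤ parsedLength x y N j}

/-- The Ziv–Merhav estimator `c_N(y|x) ln N / N`. -/
def zmEstimator (y x : ℕ → A) (N : ℕ) : ℝ := parsingCount y x N * Real.log N / N

end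

end ZivMerhav

/-! Suppose first that some word `a` has positive Q-probability but P-probability zero. Then the
cross entropy is infinite. Almost surely `a` never occurs in x but has positive frequency in y, and
each occurrence in y_1^N contains the end of a parsed word, so c_N grows at least linearly.

Otherwise, for Q-almost every y, all words of y have positive P-probability. Fix such a y and call
minus the logarithm of the P-probability of a word its cost. By (ID) the cost is additive under
concatenation up to an error k_n = o(n). Birkhoff's theorem for the cost of windows of length m,
followed by m → ∞, shows that the cost per letter of y tends to the cross entropy
(`exists_isCrossEntropy_and_ae_tendsto_cost`).

It remains to see that, for almost every x, c_N is about the cost of y_1^N divided by ln N. Cut y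
into words of cost about θ. By (FE) their lengths are O(θ), so the additivity errors are o(θ) and
the number of words is about the cost divided by θ. If θ is slightly above ln N, a given word occurs
in x_1^N with probability at most N e^{-θ}; hence few of the words occur, and each of the others
contains the end of a parsed word (`ae_eventually_le_zmEstimator`). If θ is slightly below ln N,
(KB) makes all the words occur in x_1^N, and greedy parsing uses no more words than any cutting into
occurring words (`ae_eventually_zmEstimator_le`). Borel–Cantelli makes both statements almost sure
in x, and Fubini's theorem combines them with the choice of y. -/

namespace ZivMerhav

/-! ### Birkhoff's ergodic theorem for bounded functions -/

section Birkhoff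

variable {α : Type*} {T : α → α} {g : α → ℝ}

/-- The running maximum of the partial sums `g + g ∘ T + ⋯`, the empty sum included. -/
def maxSum (T : α → α) (g : α → ℝ) : ℕ → α → ℝ
  | 0 => fun _ => 0
  | n + 1 => fun x => max 0 (g x + maxSum T g n (T x))

theorem maxSum_nonneg (n : ℕ) (x : α) : 0 ≤ maxSum T g n x := by
  cases n <;> simp [maxSum]

theorem maxSum_le_succ (n : ℕ) (x : α) : maxSum T g n x ≤ maxSum T g (n + 1) x := by
  induction n generalizing x with
  | zero => simp [maxSum]
  | succ n ih =>
    rw [maxSum, maxSum]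
    exact max_le_max le_rfl (by linarith [ih (T x)])

theorem maxSum_mono (x : α) : Monotone fun n => maxSum T g n x :=
  monotone_nat_of_le_succ fun n => maxSum_le_succ n x

theorem birkhoffSum_le_maxSum (n : ℕ) (x : α) : birkhoffSum T g n x ≤ maxSum T g n x := by
  induction n generalizing x with
  | zero => simp [maxSum]
  | succ n ih =>
    rw [maxSum, birkhoffSum_succ']
    exact le_max_of_le_right (by linarith [ih (T x)])

theorem maxSum_le {C : ℝ} (hC : ∀ x, |g x| ≤ C) (n : ℕ) (x : α) : maxSum T g n x ≤ n * C := by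
  have h0 : 0 ≤ C := (abs_nonneg _).trans (hC x)
  induction n generalizing x with
  | zero => simp [maxSum]
  | succ n ih =>
    rw [maxSum]
    refine max_le (by positivity) ?_
    push_cast
    linarith [ih (T x), le_of_abs_le (hC x)]

variable [MeasurableSpace α] {μ : Measure α}

theorem measurable_maxSum (hT : Measurable T) (hg : Measurable g) (n : ℕ) :
    Measurable (maxSum T g n) := by
  induction n with
  | zero => exact measurable_const
  | succ n ih => exact measurable_const.max (hg.add (ih.comp hT))

/-- If the mean of `g` is negative, the partial sums of `g` along an ergodic map are almost surely
bounded above. -/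
theorem ae_bddAbove_birkhoffSum [IsProbabilityMeasure μ] (hT : Ergodic T μ) (hg : Measurable g)
    {C : ℝ} (hC : ∀ x, |g x| ≤ C) (hneg : ∫ x, g x ∂μ < 0) :
    ∀ᵐ x ∂μ, BddAbove (Set.range fun n => birkhoffSum T g n x) := by
  have hTm := hT.toMeasurePreserving
  have hgi : Integrable g μ := Integrable.of_bound hg.aestronglyMeasurable C
    (Eventually.of_forall hC)
  have hMi (n : ℕ) : Integrable (maxSum T g n) μ :=
    Integrable.of_bound (measurable_maxSum hTm.measurable hg n).aestronglyMeasurable (n * C)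
      (Eventually.of_forall fun x => by
        rw [Real.norm_of_nonneg (maxSum_nonneg n x)]; exact maxSum_le hC n x)
  set D : Set α := {x | BddAbove (Set.range fun n => maxSum T g n x)} with hD
  have hDm : MeasurableSet D := measurableSet_bddAbove_range fun n =>
    measurable_maxSum hTm.measurable hg n
  -- The recursion for `maxSum` changes a bound at `T x` into one at `x`, and conversely, by means
  -- of `g x`. By ergodicity `D` is then null or conull.
  have hDinv : T ⁻¹' D = D := by
    ext x
    constructor
    · rintro ⟨b, hb⟩
      refine ⟨max 0 (g x + b), ?_⟩
      rintro _ ⟨n, rfl⟩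
      refine (maxSum_le_succ n x).trans ?_
      rw [maxSum]
      exact max_le_max le_rfl (by linarith [hb ⟨n, rfl⟩])
    · rintro ⟨b, hb⟩
      refine ⟨b - g x, ?_⟩
      rintro _ ⟨n, rfl⟩
      have := hb ⟨n + 1, rfl⟩
      simp only [maxSum] at this
      have := (le_max_right _ _).trans this
      show maxSum T g n (T x) ≤ _
      linarith
  rcases hT.toPreErgodic.ae_mem_or_ae_notMem hDm hDinv with h | h
  · filter_upwards [h] with x ⟨b, hb⟩
    refine ⟨b, ?_⟩
    rintro _ ⟨n, rfl⟩
    exact (birkhoffSum_le_maxSum n x).trans (hb ⟨n, rfl⟩)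
  -- If the maxima M_n tend to infinity almost everywhere, the differences M_{n+1} - M_n ∘ T =
  -- max(-M_n ∘ T, g) converge to `g`. Their integrals are nonnegative by invariance and
  -- monotonicity, so the mean of `g` would be nonnegative.
  · exfalso
    have hcomp (n : ℕ) : ∫ x, maxSum T g n (T x) ∂μ = ∫ x, maxSum T g n x ∂μ := by
      conv_rhs => rw [← hTm.map_eq]
      rw [integral_map hTm.measurable.aemeasurable
        (measurable_maxSum hTm.measurable hg n).aestronglyMeasurable]
    have hciT (n : ℕ) : Integrable (fun x => maxSum T g n (T x)) μ :=
      hTm.integrable_comp_of_integrable (hMi n)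
    have hincr (n : ℕ) (x : α) :
        maxSum T g (n + 1) x - maxSum T g n (T x) = max (-maxSum T g n (T x)) (g x) := by
      rw [maxSum, ← max_sub_sub_right]
      congr 1 <;> ring
    have hnn (n : ℕ) : 0 ≤ ∫ x, max (-maxSum T g n (T x)) (g x) ∂μ := by
      simp_rw [← hincr]
      rw [integral_sub (hMi _) (hciT n), hcomp, sub_nonneg]
      exact integral_mono (hMi _) (hMi _) fun x => maxSum_le_succ n x
    have hlim : Tendsto (fun n => ∫ x, max (-maxSum T g n (T x)) (g x) ∂μ) atTop
        (𝓝 (∫ x, g x ∂μ)) := by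
      refine tendsto_integral_of_dominated_convergence (fun _ => C) (fun n => ?_)
        (integrable_const _) (fun n => Eventually.of_forall fun x => ?_) ?_
      · exact (((measurable_maxSum hTm.measurable hg n).comp hTm.measurable).neg.max
          hg).aestronglyMeasurable
      · have h1 := hC x
        rw [abs_le] at h1
        have h2 := maxSum_nonneg (T := T) (g := g) n (T x)
        have h0 : 0 ≤ C := (abs_nonneg _).trans (hC x)
        rw [Real.norm_eq_abs, abs_le]
        exact ⟨h1.1.trans (le_max_right _ _), max_le (by linarith) h1.2⟩
      · filter_upwards [h] with x hx
        have hx' : T x ∉ D := fun h' => hx (hDinv ▸ h' : x ∈ D)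
        have htop : Tendsto (fun n => maxSum T g n (T x)) atTop atTop :=
          by
          refine (maxSum_mono (T x)).tendsto_atTop_atTop_iff.2 fun b => ?_
          obtain ⟨_, ⟨n, rfl⟩, hn⟩ := not_bddAbove_iff.1 hx' b
          exact ⟨n, hn.le⟩
        refine tendsto_const_nhds.congr' ?_
        filter_upwards [htop.eventually_ge_atTop (-g x)] with n hn
        rw [max_eq_right (by linarith)]
    exact absurd (ge_of_tendsto' hlim hnn) (not_le.2 hneg)

/-- Birkhoff's pointwise ergodic theorem for bounded functions, upper half. -/
theorem ae_birkhoffSum_le [IsProbabilityMeasure μ] (hT : Ergodic T μ) (hg : Measurable g)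
    {C : ℝ} (hC : ∀ x, |g x| ≤ C) {ε : ℝ} (hε : 0 < ε) :
    ∀ᵐ x ∂μ, ∀ᶠ n : ℕ in atTop, birkhoffSum T g n x ≤ n * (∫ x, g x ∂μ + ε) := by
  have hgi : Integrable g μ := Integrable.of_bound hg.aestronglyMeasurable C
    (Eventually.of_forall hC)
  -- One half of `ε` makes the mean of `g - c` negative; the other half absorbs the random bound `b`
  -- for large `n`.
  set c := ∫ x, g x ∂μ + ε / 2
  have hneg : ∫ x, (g x - c) ∂μ < 0 := by
    rw [integral_sub hgi (integrable_const _)]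
    simp [c, hε]
  filter_upwards [ae_bddAbove_birkhoffSum hT (hg.sub_const c) (C := C + |c|)
    (fun x => (abs_sub _ _).trans (by linarith [hC x])) hneg] with x ⟨b, hb⟩
  filter_upwards [tendsto_natCast_atTop_atTop.eventually_ge_atTop (b / (ε / 2))] with n hn
  have h1 : birkhoffSum T (fun x => g x - c) n x ≤ b := hb ⟨n, rfl⟩
  have h2 : birkhoffSum T (fun x => g x - c) n x = birkhoffSum T g n x - n * c := by
    simp [birkhoffSum, Finset.sum_sub_distrib]
  rw [div_le_iff₀ (by positivity)] at hn
  have h3 : (n : ℝ) * (∫ x, g x ∂μ + ε) = n * c + n * (ε / 2) := by simp only [c]; ring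
  linarith

/-- Birkhoff's pointwise ergodic theorem for bounded functions and ergodic maps. -/
theorem ae_tendsto_birkhoffSum_div [IsProbabilityMeasure μ] (hT : Ergodic T μ)
    (hg : Measurable g) {C : ℝ} (hC : ∀ x, |g x| ≤ C) :
    ∀ᵐ x ∂μ, Tendsto (fun n : ℕ => birkhoffSum T g n x / n) atTop (𝓝 (∫ x, g x ∂μ)) := by
  have hup := ae_all_iff.2 fun m : ℕ => ae_birkhoffSum_le hT hg hC (Nat.one_div_pos_of_nat (n := m))
  have hlo := ae_all_iff.2 fun m : ℕ => ae_birkhoffSum_le hT hg.neg (C := C)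
    (fun x => by simpa using hC x) (Nat.one_div_pos_of_nat (n := m))
  filter_upwards [hup, hlo] with x h1 h2
  rw [Metric.tendsto_atTop']
  intro ε hε
  obtain ⟨m, hm⟩ := exists_nat_one_div_lt hε
  obtain ⟨N, hN⟩ := eventually_atTop.1 ((h1 m).and (h2 m))
  refine ⟨N, fun n hn => ?_⟩
  obtain ⟨h3, h4⟩ := hN n hn.le
  have hn0 : (0 : ℝ) < n := by exact_mod_cast (Nat.zero_le N).trans_lt hn
  have h5 : birkhoffSum T (-g) n x = -birkhoffSum T g n x := by simp [birkhoffSum]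
  have h6 : ∫ x, (-g) x ∂μ = -∫ x, g x ∂μ := by simp [integral_neg]
  rw [h5, h6] at h4
  rw [Real.dist_eq, abs_lt]
  have h7 : birkhoffSum T g n x / n ≤ ∫ x, g x ∂μ + 1 / ((m : ℝ) + 1) := by
    rw [div_le_iff₀ hn0]; linarith
  have h8 : ∫ x, g x ∂μ - 1 / ((m : ℝ) + 1) ≤ birkhoffSum T g n x / n := by
    rw [le_div_iff₀ hn0]; linarith
  constructor <;> linarith

end Birkhoff

/-! ### Combinatorics of the sequential parsing -/

section Parsing

variable {A : Type*} {x y : ℕ → A} {N : ℕ}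

theorem OccursIn.mono {N' i l i' l' : ℕ} (h : OccursIn x y N i l) (hi : i ≤ i')
    (hl : i' + l' ≤ i + l) (hN : N ≤ N') : OccursIn x y N' i' l' := by
  obtain ⟨r, hr, h⟩ := h
  refine ⟨r + (i' - i), by omega, fun j hj => ?_⟩
  have := h (i' - i + j) (by omega)
  rw [show r + (i' - i) + j = r + (i' - i + j) by omega, this]
  congr 1
  omega

theorem le_wordLength {i l : ℕ} (h : OccursIn x y N i l) (hl : i + l ≤ N) :
    l ≤ wordLength x y N i := by
  classical
  exact le_max_of_le_right (Nat.le_findGreatest (by omega) h)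

theorem occursIn_wordLength {i : ℕ} (h : 2 ≤ wordLength x y N i) :
    OccursIn x y N i (wordLength x y N i) := by
  classical
  have h1 : wordLength x y N i = Nat.findGreatest (OccursIn x y N i) (N - i) := by
    unfold wordLength at h ⊢
    omega
  rw [h1] at h ⊢
  exact Nat.findGreatest_of_ne_zero rfl (by omega)

theorem strictMono_parsedLength : StrictMono (parsedLength x y N) :=
  strictMono_nat_of_lt_succ fun j => by
    have : 1 ≤ wordLength x y N (parsedLength x y N j) := le_max_left _ _
    simp only [parsedLength]
    omega

theorem le_parsedLength_parsingCount : N ≤ parsedLength x y N (parsingCount y x N) :=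
  Nat.sInf_mem (s := {j | N ≤ parsedLength x y N j}) ⟨N, strictMono_parsedLength.le_apply⟩

theorem parsingCount_le {j : ℕ} (h : N ≤ parsedLength x y N j) : parsingCount y x N ≤ j :=
  Nat.sInf_le h

/-- A parsed word ends in each window of `y` that does not occur in `x`. -/
theorem exists_parsedLength_mem {i l : ℕ} (hl : 1 ≤ l) (hi : i + l ≤ N)
    (h : ¬OccursIn x y N i l) :
    ∃ j < parsingCount y x N, i < parsedLength x y N (j + 1) ∧
      parsedLength x y N (j + 1) ≤ i + l := by
  have hex : ∃ j, i < parsedLength x y N (j + 1) :=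
    ⟨i, (Nat.lt_succ_self i).trans_le strictMono_parsedLength.le_apply⟩
  classical
  set j := Nat.find hex
  have hj : i < parsedLength x y N (j + 1) := Nat.find_spec hex
  have hj' : parsedLength x y N j ≤ i := by
    rcases Nat.eq_zero_or_pos j with h0 | h0
    · rw [h0]; exact Nat.zero_le _
    · have := Nat.find_min hex (m := j - 1) (by omega)
      rw [Nat.sub_add_cancel h0] at this
      omega
  have hc := le_parsedLength_parsingCount (x := x) (y := y) (N := N)
  refine ⟨j, strictMono_parsedLength.lt_iff_lt.1 (hj'.trans_lt (lt_of_lt_of_le (by omega) hc)),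
    hj, not_lt.1 fun hlt => h ?_⟩
  have hs : parsedLength x y N (j + 1) =
    parsedLength x y N j + wordLength x y N (parsedLength x y N j) := rfl
  -- A parsed word covering the window and reaching beyond it has length at least 2, so it is a true
  -- match and not the one-letter default; the window would then occur in `x` too.
  exact (occursIn_wordLength (by omega)).mono hj' (by omega) le_rfl

/-- Consecutive words of `y`, all but those indexed by `B` not occurring in `x`. -/
theorem le_parsingCount_add_card {s : ℕ → ℕ} (hs : StrictMono s) {J : ℕ} (hJ : s J ≤ N)
    (B : Finset ℕ) (hB : ∀ j < J, j ∉ B → ¬OccursIn x y N (s j) (s (j + 1) - s j)) :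
    J ≤ parsingCount y x N + B.card := by
  classical
  have key : ∀ j, ∃ c, j ∈ Finset.range J \ B → c < parsingCount y x N ∧
      s j < parsedLength x y N (c + 1) ∧ parsedLength x y N (c + 1) ≤ s (j + 1) := by
    intro j
    by_cases hj : j ∈ Finset.range J \ B
    · simp only [Finset.mem_sdiff, Finset.mem_range] at hj
      have h1 : s j < s (j + 1) := hs (Nat.lt_succ_self j)
      have h2 : s (j + 1) ≤ s J := hs.monotone hj.1
      obtain ⟨c, hc, h3, h4⟩ := exists_parsedLength_mem (l := s (j + 1) - s j) (by omega)
        (by omega) (hB j hj.1 hj.2)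
      exact ⟨c, fun _ => ⟨hc, h3, by omega⟩⟩
    · exact ⟨0, fun h => absurd h hj⟩
  choose c hc using key
  -- The windows are disjoint, so the ends of parsed words found in them are distinct.
  have hcard : (Finset.range J \ B).card ≤ (Finset.range (parsingCount y x N)).card := by
    refine Finset.card_le_card_of_injOn c (fun j hj => ?_) fun j hj j' hj' hjj => ?_
    · simpa using (hc j hj).1
    · obtain ⟨-, h1, h2⟩ := hc j hj
      obtain ⟨-, h3, h4⟩ := hc j' hj'
      rw [hjj] at h1 h2
      by_contra hne
      rcases lt_or_gt_of_ne hne with h | h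
      · have := hs.monotone (Nat.succ_le_of_lt h)
        simp only [Nat.succ_eq_add_one] at this
        omega
      · have := hs.monotone (Nat.succ_le_of_lt h)
        simp only [Nat.succ_eq_add_one] at this
        omega
  rw [Finset.card_range] at hcard
  have := Finset.le_card_sdiff B (Finset.range J)
  rw [Finset.card_range] at this
  omega

/-- The windows may overlap here, but the end of a parsed word lies in at most `m` windows of length
`m`. -/
theorem card_le_mul_parsingCount {m : ℕ} (hm : 1 ≤ m) (I : Finset ℕ)
    (hI : ∀ i ∈ I, i + m ≤ N ∧ ¬OccursIn x y N i m) :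
    I.card ≤ m * parsingCount y x N := by
  classical
  have hsub : I ⊆ (Finset.range (parsingCount y x N)).biUnion fun j =>
      Finset.Ico (parsedLength x y N (j + 1) - m) (parsedLength x y N (j + 1)) := by
    intro i hi
    obtain ⟨j, hj, h1, h2⟩ := exists_parsedLength_mem hm (hI i hi).1 (hI i hi).2
    simp only [Finset.mem_biUnion, Finset.mem_range, Finset.mem_Ico]
    exact ⟨j, hj, by omega, h1⟩
  refine (Finset.card_le_card hsub).trans ((Finset.card_biUnion_le_card_mul _ _ m fun j _ => ?_).trans
    (by rw [Finset.card_range, mul_comm]))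
  rw [Nat.card_Ico]
  omega

/-- If `y` is cut into words occurring in `x`, the parsing needs no more words. -/
theorem parsingCount_le_of_occursIn {s : ℕ → ℕ} (hs : StrictMono s) (h0 : s 0 = 0) {J : ℕ}
    (hJ : N ≤ s J) (h : ∀ j < J, OccursIn x y N (s j) (s (j + 1) - s j)) :
    parsingCount y x N ≤ J := by
  -- The greedy parsing never falls behind: the part of the current word not yet parsed is a suffix
  -- of a word that occurs in `x`, so it occurs as well. The minimum is needed because matches stop
  -- at the `N`-th letter.
  have key : ∀ j ≤ J, min N (s j) ≤ parsedLength x y N j := by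
    intro j
    induction j with
    | zero => simp [h0]
    | succ j ih =>
      intro hj
      have h1 := ih (by omega)
      have hlt : s j < s (j + 1) := hs (Nat.lt_succ_self j)
      have hstep : parsedLength x y N j < parsedLength x y N (j + 1) :=
        strictMono_parsedLength (Nat.lt_succ_self j)
      by_cases h2 : min N (s (j + 1)) ≤ parsedLength x y N j
      · exact h2.trans hstep.le
      · have h3 : min N (s (j + 1)) - parsedLength x y N j ≤
            wordLength x y N (parsedLength x y N j) :=
          le_wordLength ((h j (by omega)).mono (by omega) (by omega) le_rfl) (by omega)
        have hs : parsedLength x y N (j + 1) =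
          parsedLength x y N j + wordLength x y N (parsedLength x y N j) := rfl
        omega
  refine parsingCount_le ?_
  have := key J le_rfl
  rwa [min_eq_left hJ] at this

end Parsing

/-! ### Almost additive costs and cutting into words of given cost -/

/-- The end points of consecutive words, if the word that starts at `i` has length `L i`. -/
def cuts (L : ℕ → ℕ) : ℕ → ℕ
  | 0 => 0
  | j + 1 => cuts L j + L (cuts L j)

theorem strictMono_cuts {L : ℕ → ℕ} (hL : ∀ i, 1 ≤ L i) : StrictMono (cuts L) :=
  strictMono_nat_of_lt_succ fun j => by
    have := hL (cuts L j)
    simp only [cuts]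
    omega

theorem exists_cuts_le_lt {L : ℕ → ℕ} (hL : ∀ i, 1 ≤ L i) (N : ℕ) :
    ∃ J, cuts L J ≤ N ∧ N < cuts L (J + 1) := by
  classical
  have hex : ∃ j, N < cuts L (j + 1) :=
    ⟨N, (Nat.lt_succ_self N).trans_le (strictMono_cuts hL).le_apply⟩
  refine ⟨Nat.find hex, ?_, Nat.find_spec hex⟩
  rcases Nat.eq_zero_or_pos (Nat.find hex) with h0 | h0
  · rw [h0]; exact Nat.zero_le _
  · have := Nat.find_min hex (m := Nat.find hex - 1) (by omega)
    rw [Nat.sub_add_cancel h0] at this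
    omega

/-- A nonnegative cost `F i n` of the word of length `n` that starts at `i`, additive under
concatenation up to an error `k n` depending on the length of the first word. -/
structure AlmostAdditive (F : ℕ → ℕ → ℝ) (k : ℕ → ℝ) (C : ℝ) : Prop where
  monotone_error : Monotone k
  error_nonneg : ∀ n, 0 ≤ k n
  zero : ∀ i, F i 0 = 0
  mono : ∀ i n i' n', i' ≤ i → i + n ≤ i' + n' → F i n ≤ F i' n'
  add_le : ∀ i n m, F i n + F (i + n) m ≤ F i (n + m) + k n
  le_add : ∀ i n m, F i (n + m) ≤ F i n + F (i + n) m + k n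
  one_le : ∀ i, F i 1 + k 1 ≤ C

namespace AlmostAdditive

variable {F : ℕ → ℕ → ℝ} {k : ℕ → ℝ} {C : ℝ}

theorem nonneg (h : AlmostAdditive F k C) (i n : ℕ) : 0 ≤ F i n := by
  rw [← h.zero i]
  exact h.mono _ _ _ _ le_rfl (by omega)

theorem const_nonneg (h : AlmostAdditive F k C) : 0 ≤ C :=
  (add_nonneg (h.nonneg 0 1) (h.error_nonneg 1)).trans (h.one_le 0)

theorem le_mul_add (h : AlmostAdditive F k C) (i n m : ℕ) :
    F i (n + m) ≤ n * C + F (i + n) m := by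
  induction n generalizing i with
  | zero => simp
  | succ n ih =>
    have h1 := h.le_add i 1 (n + m)
    have h2 := ih (i + 1)
    rw [show i + 1 + n = i + (n + 1) by ring] at h2
    rw [show n + 1 + m = 1 + (n + m) by ring]
    push_cast
    linarith [h.one_le i]

theorem le_mul (h : AlmostAdditive F k C) (i n : ℕ) : F i n ≤ n * C := by
  simpa [h.zero] using h.le_mul_add i n 0

/-- The induction splits off the first word, since the error depends on the length of the first
factor only; thus each error is `k` at the length of a single word. -/
theorem le_sum (h : AlmostAdditive F k C) {s : ℕ → ℕ} (hs : Monotone s) (J : ℕ) :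
    F (s 0) (s J - s 0) ≤
      ∑ j ∈ Finset.range J, (F (s j) (s (j + 1) - s j) + k (s (j + 1) - s j)) := by
  induction J generalizing s with
  | zero => simp [h.zero]
  | succ J ih =>
    have h1 := ih (s := fun j => s (j + 1)) fun a b hab => hs (by omega)
    have h01 : s 0 ≤ s 1 := hs (by omega)
    have h1J : s 1 ≤ s (J + 1) := hs (by omega)
    have h2 := h.le_add (s 0) (s 1 - s 0) (s (J + 1) - s 1)
    rw [show s 1 - s 0 + (s (J + 1) - s 1) = s (J + 1) - s 0 by omega,
      show s 0 + (s 1 - s 0) = s 1 by omega] at h2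
    rw [Finset.sum_range_succ']
    simp only [zero_add] at h1 ⊢
    linarith

theorem sum_le (h : AlmostAdditive F k C) {s : ℕ → ℕ} (hs : Monotone s) (J : ℕ) :
    ∑ j ∈ Finset.range J, (F (s j) (s (j + 1) - s j) - k (s (j + 1) - s j)) ≤
      F (s 0) (s J - s 0) := by
  induction J generalizing s with
  | zero => simp [h.zero]
  | succ J ih =>
    have h1 := ih (s := fun j => s (j + 1)) fun a b hab => hs (by omega)
    have h01 : s 0 ≤ s 1 := hs (by omega)
    have h1J : s 1 ≤ s (J + 1) := hs (by omega)
    have h2 := h.add_le (s 0) (s 1 - s 0) (s (J + 1) - s 1)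
    rw [show s 1 - s 0 + (s (J + 1) - s 1) = s (J + 1) - s 0 by omega,
      show s 0 + (s 1 - s 0) = s 1 by omega] at h2
    rw [Finset.sum_range_succ']
    simp only [zero_add] at h1 ⊢
    linarith

theorem le_sum_blocks (h : AlmostAdditive F k C) (i m q e : ℕ) :
    F i (q * m + e) ≤
      ∑ j ∈ Finset.range q, F (i + j * m) m + q * k m + F (i + q * m) e := by
  induction q generalizing e with
  | zero => simp
  | succ q ih =>
    have h1 := ih (m + e)
    have h2 := h.le_add (i + q * m) m e
    rw [Nat.succ_mul, Finset.sum_range_succ, ← add_assoc i, add_assoc (q * m)]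
    push_cast
    linarith

theorem sum_range_sum_range_mul (G : ℕ → ℝ) (m q : ℕ) :
    ∑ r ∈ Finset.range m, ∑ j ∈ Finset.range q, G (r + j * m) =
      ∑ i ∈ Finset.range (q * m), G i := by
  rw [Finset.sum_comm]
  induction q with
  | zero => simp
  | succ q ih =>
    rw [Finset.sum_range_succ, ih, Nat.succ_mul, Finset.sum_range_add]
    simp only [add_comm]

/-- The cost of `(q + 1) * m` letters is compared with the cost of all windows of length `m`. -/
theorem abs_mul_sub_sum_le_of_blocks (h : AlmostAdditive F k C) (m q : ℕ) :
    ∑ i ∈ Finset.range (q * m), F i m - q * m * k m ≤ m * F 0 ((q + 1) * m) ∧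
    m * F 0 ((q + 1) * m) ≤ ∑ i ∈ Finset.range (q * m), F i m + q * m * k m + m * (m * C) := by
  have hs (r : ℕ) : Monotone fun j => r + j * m := fun a b hab =>
    Nat.add_le_add_left (Nat.mul_le_mul_right m hab) r
  have hd (r j : ℕ) : r + (j + 1) * m - (r + j * m) = m := by
    rw [Nat.succ_mul]; omega
  -- For each offset `r < m`, `q` consecutive windows of length `m` fit into the `(q + 1) * m`
  -- letters. Summing over `r` counts each of the `q * m` starting points once.
  have hlow (r : ℕ) (hr : r ∈ Finset.range m) :
      ∑ j ∈ Finset.range q, F (r + j * m) m - q * k m ≤ F 0 ((q + 1) * m) := by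
    have hr : r < m := Finset.mem_range.1 hr
    have h1 := h.sum_le (hs r) q
    simp only [hd, Finset.sum_sub_distrib, Finset.sum_const, Finset.card_range,
      nsmul_eq_mul] at h1
    refine h1.trans (h.mono _ _ _ _ (Nat.zero_le _) ?_)
    rw [Nat.succ_mul]; omega
  -- The `r` letters before the windows and the `m - r` letters after them cost at most `m * C`
  -- together.
  have hup (r : ℕ) (hr : r ∈ Finset.range m) :
      F 0 ((q + 1) * m) ≤ ∑ j ∈ Finset.range q, F (r + j * m) m + q * k m + m * C := by
    have hr : r < m := Finset.mem_range.1 hr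
    have h1 := h.le_mul_add 0 r (q * m + (m - r))
    have h2 := h.le_sum_blocks r m q (m - r)
    have h3 := h.le_mul (r + q * m) (m - r)
    rw [show r + (q * m + (m - r)) = (q + 1) * m by rw [Nat.succ_mul]; omega, zero_add] at h1
    rw [Nat.cast_sub hr.le] at h3
    linarith
  constructor
  · have := Finset.sum_le_sum hlow
    rw [Finset.sum_sub_distrib, sum_range_sum_range_mul (fun i => F i m)] at this
    simp only [Finset.sum_const, Finset.card_range, nsmul_eq_mul] at this
    linarith
  · have := Finset.sum_le_sum hup
    rw [Finset.sum_add_distrib, Finset.sum_add_distrib,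
      sum_range_sum_range_mul (fun i => F i m)] at this
    simp only [Finset.sum_const, Finset.card_range, nsmul_eq_mul] at this
    linarith

/-- This compares the cost of `n` letters with a Birkhoff sum of the cost of `m` letters. Rounding
`n` to a multiple of `m` affects at most `2 * m` windows, each of cost at most `m * C`. -/
theorem abs_mul_sub_sum_le (h : AlmostAdditive F k C) {m : ℕ} (hm : 1 ≤ m) (n : ℕ) :
    |m * F 0 n - ∑ i ∈ Finset.range n, F i m| ≤ n * k m + 2 * m * (m * C) := by
  have hC := h.const_nonneg
  have hk := h.error_nonneg m
  have hsum (a b : ℕ) (hab : a ≤ b) : ∑ i ∈ Finset.range a, F i m ≤ ∑ i ∈ Finset.range b, F i m :=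
    Finset.sum_le_sum_of_subset_of_nonneg (Finset.range_subset_range.2 hab)
      fun i _ _ => h.nonneg i m
  have hn := Nat.div_add_mod' n m
  have hmod := Nat.mod_lt n hm
  set q := n / m with hq
  have hqn : ((q : ℝ) * m) * k m ≤ n * k m := by
    gcongr
    exact_mod_cast (show q * m ≤ n by omega)
  have hmpos : (0 : ℝ) ≤ m := Nat.cast_nonneg m
  have hmC : 0 ≤ (m : ℝ) * (m * C) := by positivity
  rw [abs_le]
  constructor
  · rcases Nat.eq_zero_or_pos q with h0 | h0
    · have h1 : ∑ i ∈ Finset.range n, F i m ≤ ∑ i ∈ Finset.range n, m * C :=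
        Finset.sum_le_sum fun i _ => h.le_mul i m
      rw [Finset.sum_const, Finset.card_range, nsmul_eq_mul] at h1
      have h2 : (n : ℝ) * (m * C) ≤ m * (m * C) := by
        gcongr
        rw [h0] at hn
        omega
      have h3 : 0 ≤ m * F 0 n := mul_nonneg hmpos (h.nonneg 0 n)
      have h4 : 0 ≤ n * k m := by positivity
      linarith
    · obtain ⟨p, hp⟩ : ∃ p, q = p + 1 := ⟨q - 1, by omega⟩
      have h1 := (h.abs_mul_sub_sum_le_of_blocks m p).1
      have h2 : m * F 0 ((p + 1) * m) ≤ m * F 0 n :=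
        mul_le_mul_of_nonneg_left (h.mono _ _ _ _ le_rfl (by rw [← hp]; omega)) hmpos
      have h3 : ∑ i ∈ Finset.range n, F i m ≤ ∑ i ∈ Finset.range (p * m + 2 * m), F i m :=
        hsum _ _ (by rw [hp, Nat.succ_mul] at hn; omega)
      rw [Finset.sum_range_add] at h3
      have h4 : ∑ i ∈ Finset.range (2 * m), F (p * m + i) m ≤ ∑ i ∈ Finset.range (2 * m), m * C :=
        Finset.sum_le_sum fun i _ => h.le_mul _ m
      rw [Finset.sum_const, Finset.card_range, nsmul_eq_mul] at h4
      push_cast at h4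
      have h5 : ((p : ℝ) * m) * k m ≤ ((q : ℝ) * m) * k m := by
        gcongr
        omega
      linarith
  · have h1 := (h.abs_mul_sub_sum_le_of_blocks m q).2
    have h2 : m * F 0 n ≤ m * F 0 ((q + 1) * m) :=
      mul_le_mul_of_nonneg_left (h.mono _ _ _ _ le_rfl (by rw [Nat.succ_mul]; omega)) hmpos
    have h3 := hsum (q * m) n (by omega)
    linarith

end AlmostAdditive

/-- The shortest length at which the word that starts at `i` costs at least `θ`. -/
noncomputable def firstLength (F : ℕ → ℕ → ℝ) (θ : ℝ) (i : ℕ) : ℕ := sInf {l | θ ≤ F i l}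

/-- A bound on `firstLength` for costs that are at least `γ * n` from the length `n₀` on. -/
noncomputable def maxLength (n₀ : ℕ) (γ θ : ℝ) : ℕ := n₀ + ⌈θ / γ⌉₊

theorem le_maxLength_mul {n₀ : ℕ} {γ θ : ℝ} (hγ : 0 < γ) : θ ≤ γ * maxLength n₀ γ θ := by
  have h1 : θ / γ ≤ ⌈θ / γ⌉₊ := Nat.le_ceil _
  rw [div_le_iff₀ hγ] at h1
  have h2 : 0 ≤ γ * (n₀ : ℝ) := by positivity
  rw [maxLength]
  push_cast
  linarith

theorem maxLength_le {n₀ : ℕ} {γ θ : ℝ} (hγ : 0 < γ) (hθ : 0 ≤ θ) :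
    (maxLength n₀ γ θ : ℝ) ≤ n₀ + 1 + θ / γ := by
  have h1 : (⌈θ / γ⌉₊ : ℝ) < θ / γ + 1 := Nat.ceil_lt_add_one (by positivity)
  rw [maxLength]
  push_cast
  linarith

theorem tendsto_maxLength {n₀ : ℕ} {γ : ℝ} (hγ : 0 < γ) :
    Tendsto (maxLength n₀ γ) atTop atTop :=
  tendsto_atTop_mono (fun _ => Nat.le_add_left _ _)
    (tendsto_nat_ceil_atTop.comp (tendsto_id.atTop_div_const hγ))

theorem isBigO_maxLength {n₀ : ℕ} {γ : ℝ} (hγ : 0 < γ) :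
    (fun θ => (maxLength n₀ γ θ : ℝ)) =O[atTop] (fun θ : ℝ => θ) := by
  refine IsBigO.of_bound (n₀ + 1 + 1 / γ) ?_
  filter_upwards [eventually_ge_atTop 1] with θ hθ
  rw [Real.norm_of_nonneg (by positivity), Real.norm_of_nonneg (by positivity)]
  refine (maxLength_le hγ (by positivity)).trans ?_
  have : (n₀ + 1 : ℝ) * 1 ≤ (n₀ + 1) * θ := by gcongr
  rw [add_mul, one_div_mul_eq_div]
  linarith

/-- Words cut at cost `θ` have length at most `maxLength n₀ γ θ`, which is O(θ); hence their
additivity errors are negligible against `θ`. -/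
theorem isLittleO_comp_maxLength {k : ℕ → ℝ} (hk : k =o[atTop] fun n : ℕ => (n : ℝ)) {n₀ : ℕ}
    {γ : ℝ} (hγ : 0 < γ) : (fun θ => k (maxLength n₀ γ θ)) =o[atTop] (fun θ : ℝ => θ) :=
  (hk.comp_tendsto (tendsto_maxLength hγ)).trans_isBigO (isBigO_maxLength hγ)

namespace AlmostAdditive

variable {F : ℕ → ℕ → ℝ} {k : ℕ → ℝ} {C γ θ : ℝ} {n₀ : ℕ}

theorem lt_of_lt_firstLength {i l : ℕ} (hl : l < firstLength F θ i) : F i l < θ :=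
  not_le.1 fun h => Nat.notMem_of_lt_sInf hl h

theorem maxLength_mem (hγ : 0 < γ) (hF : ∀ i, ∀ n ≥ n₀, γ * n ≤ F i n) (i : ℕ) :
    θ ≤ F i (maxLength n₀ γ θ) :=
  (le_maxLength_mul hγ).trans (hF i _ (Nat.le_add_right _ _))

theorem firstLength_le_maxLength (hγ : 0 < γ) (hF : ∀ i, ∀ n ≥ n₀, γ * n ≤ F i n) (i : ℕ) :
    firstLength F θ i ≤ maxLength n₀ γ θ :=
  Nat.sInf_le (maxLength_mem hγ hF i)

theorem le_firstLength (hγ : 0 < γ) (hF : ∀ i, ∀ n ≥ n₀, γ * n ≤ F i n) (i : ℕ) :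
    θ ≤ F i (firstLength F θ i) :=
  Nat.sInf_mem (s := {l | θ ≤ F i l}) ⟨_, maxLength_mem hγ hF i⟩

theorem one_le_firstLength (h : AlmostAdditive F k C) (hγ : 0 < γ)
    (hF : ∀ i, ∀ n ≥ n₀, γ * n ≤ F i n) (hθ : 0 < θ) (i : ℕ) : 1 ≤ firstLength F θ i := by
  by_contra hlt
  have h1 := le_firstLength (θ := θ) hγ hF i
  rw [show firstLength F θ i = 0 by omega, h.zero] at h1
  linarith

theorem F_one_le (h : AlmostAdditive F k C) (i : ℕ) : F i 1 ≤ C := by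
  linarith [h.one_le i, h.error_nonneg 1]

theorem two_le_firstLength (h : AlmostAdditive F k C) (hγ : 0 < γ)
    (hF : ∀ i, ∀ n ≥ n₀, γ * n ≤ F i n) (hθ : C < θ) (i : ℕ) : 2 ≤ firstLength F θ i := by
  have h0 := h.one_le_firstLength hγ hF (h.const_nonneg.trans_lt hθ) i
  by_contra hlt
  have h1 := le_firstLength (θ := θ) hγ hF i
  rw [show firstLength F θ i = 1 by omega] at h1
  linarith [h.F_one_le i]

/-- One more letter adds at most `C` and an error. So the word that first reaches `θ` overshoots it
only slightly, and the word one letter shorter falls only slightly below it. -/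
theorem firstLength_le_pred (h : AlmostAdditive F k C) (hγ : 0 < γ)
    (hF : ∀ i, ∀ n ≥ n₀, γ * n ≤ F i n) (hθ : 0 < θ) (i : ℕ) :
    F i (firstLength F θ i) ≤ F i (firstLength F θ i - 1) + C + k (maxLength n₀ γ θ) := by
  have h0 := h.one_le_firstLength hγ hF hθ i
  have h1 := h.le_add i (firstLength F θ i - 1) 1
  rw [Nat.sub_add_cancel h0] at h1
  have h2 : k (firstLength F θ i - 1) ≤ k (maxLength n₀ γ θ) :=
    h.monotone_error ((Nat.sub_le _ _).trans (firstLength_le_maxLength hγ hF i))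
  linarith [h.F_one_le (i + (firstLength F θ i - 1))]

/-- If few words of cost about `θ` of `y` occur in `x`, then there are many parsed words. -/
theorem le_parsingCount_mul (h : AlmostAdditive F k C) (hγ : 0 < γ)
    (hF : ∀ i, ∀ n ≥ n₀, γ * n ≤ F i n) (hθ : 0 < θ) {A : Type*} {x y : ℕ → A} {N M : ℕ}
    (hNM : N ≤ M) (B : Finset ℕ) (hB : ∀ i < M, OccursIn x y M i (firstLength F θ i) → i ∈ B) :
    F 0 N ≤ (parsingCount y x N + B.card + 1) * (θ + C + 2 * k (maxLength n₀ γ θ)) := by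
  classical
  set K := k (maxLength n₀ γ θ) with hK
  have hL := h.one_le_firstLength hγ hF hθ
  have hmono := strictMono_cuts hL
  -- The first `J` words lie within the `N` letters and force ends of parsed words; `J + 1` words
  -- are needed to cover the cost of all `N` letters.
  obtain ⟨J, hJ, hJ'⟩ := exists_cuts_le_lt hL N
  have hK0 : 0 ≤ K := h.error_nonneg _
  have hD : 0 ≤ θ + C + 2 * K := by linarith [h.const_nonneg]
  have hd (j : ℕ) : cuts (firstLength F θ) (j + 1) - cuts (firstLength F θ) j =
      firstLength F θ (cuts (firstLength F θ) j) := by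
    simp [cuts]
  have hcount : J ≤ parsingCount y x N +
      ((Finset.range J).filter fun j => cuts (firstLength F θ) j ∈ B).card := by
    refine le_parsingCount_add_card hmono hJ _ fun j hj hjB hocc => hjB ?_
    rw [hd] at hocc
    simp only [Finset.mem_filter, Finset.mem_range]
    exact ⟨hj, hB _ ((hmono hj).trans_le (hJ.trans hNM)) (hocc.mono le_rfl le_rfl hNM)⟩
  have hcard : ((Finset.range J).filter fun j => cuts (firstLength F θ) j ∈ B).card ≤ B.card :=
    Finset.card_le_card_of_injOn (cuts (firstLength F θ))
      (fun j hj => by simp only [Finset.coe_filter, Set.mem_ofPred_eq] at hj; exact hj.2)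
      hmono.injective.injOn
  have hsum := h.le_sum hmono.monotone (J + 1)
  simp only [hd, show cuts (firstLength F θ) 0 = 0 from rfl] at hsum
  have hterm : ∀ j ∈ Finset.range (J + 1),
      F (cuts (firstLength F θ) j) (firstLength F θ (cuts (firstLength F θ) j)) +
        k (firstLength F θ (cuts (firstLength F θ) j)) ≤ θ + C + 2 * K := fun j _ => by
    set i := cuts (firstLength F θ) j
    have h1 := h.firstLength_le_pred hγ hF hθ i
    have h2 := lt_of_lt_firstLength (F := F) (θ := θ) (i := i) (l := firstLength F θ i - 1)
      (by have := hL i; omega)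
    have h3 : k (firstLength F θ i) ≤ K :=
      h.monotone_error (firstLength_le_maxLength hγ hF i)
    linarith
  have hsum2 := Finset.sum_le_sum hterm
  rw [Finset.sum_const, Finset.card_range, nsmul_eq_mul] at hsum2
  have hN : F 0 N ≤ F 0 (cuts (firstLength F θ) (J + 1)) :=
    h.mono _ _ _ _ le_rfl (by omega)
  have hJR : ((J + 1 : ℕ) : ℝ) ≤ parsingCount y x N + B.card + 1 := by
    exact_mod_cast (show J + 1 ≤ parsingCount y x N + B.card + 1 by omega)
  simp only [Nat.sub_zero] at hsum
  calc F 0 N ≤ _ := hN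
    _ ≤ _ := hsum
    _ ≤ _ := hsum2
    _ ≤ _ := mul_le_mul_of_nonneg_right hJR hD

/-- If all words of `y` of cost just below `θ` occur in `x`, then there are few parsed words. -/
theorem parsingCount_mul_le (h : AlmostAdditive F k C) (hγ : 0 < γ)
    (hF : ∀ i, ∀ n ≥ n₀, γ * n ≤ F i n) (hθ : C < θ)
    (hθ' : 0 ≤ θ - C - 2 * k (maxLength n₀ γ θ)) {A : Type*} {x y : ℕ → A} {N : ℕ}
    (hN : 1 ≤ N) (hocc : ∀ i < N, OccursIn x y N i (firstLength F θ i - 1)) :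
    (parsingCount y x N - 1) * (θ - C - 2 * k (maxLength n₀ γ θ)) ≤ F 0 N := by
  set K := k (maxLength n₀ γ θ) with hK
  set U : ℕ → ℕ := fun i => firstLength F θ i - 1 with hU
  have hθ0 : 0 < θ := h.const_nonneg.trans_lt hθ
  have hL : ∀ i, 1 ≤ U i := fun i => by
    have := h.two_le_firstLength hγ hF hθ i
    simp only [hU]
    omega
  have hmono := strictMono_cuts hL
  -- With `N - 1`, the `J + 1` words reach the `N`-th letter while each starts before it, as `hocc`
  -- requires.
  obtain ⟨J, hJ, hJ'⟩ := exists_cuts_le_lt hL (N - 1)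
  have hd (j : ℕ) : cuts U (j + 1) - cuts U j = U (cuts U j) := by
    simp [cuts]
  have hcount : parsingCount y x N ≤ J + 1 := by
    refine parsingCount_le_of_occursIn hmono rfl (by omega) fun j hj => ?_
    rw [hd]
    have := hmono.monotone (Nat.le_of_lt_succ hj)
    exact hocc _ (by omega)
  have hsum := h.sum_le hmono.monotone J
  simp only [hd] at hsum
  have hterm : ∀ j ∈ Finset.range J, θ - C - 2 * K ≤
      F (cuts U j) (U (cuts U j)) - k (U (cuts U j)) := fun j _ => by
    set i := cuts U j
    have h1 := h.firstLength_le_pred hγ hF hθ0 i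
    have h2 := le_firstLength (θ := θ) hγ hF i
    have h3 : k (U i) ≤ K :=
      h.monotone_error ((Nat.sub_le _ _).trans (firstLength_le_maxLength hγ hF i))
    simp only [hU] at h3 ⊢
    linarith
  have hsum2 := Finset.sum_le_sum hterm
  rw [Finset.sum_const, Finset.card_range, nsmul_eq_mul] at hsum2
  have hN : F (cuts U 0) (cuts U J - cuts U 0) ≤ F 0 N :=
    h.mono _ _ _ _ (by simp) (by simp only [cuts]; omega)
  have hJR : (parsingCount y x N : ℝ) - 1 ≤ J := by
    rw [sub_le_iff_le_add]
    exact_mod_cast hcount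
  calc _ ≤ J * (θ - C - 2 * K) := mul_le_mul_of_nonneg_right hJR hθ'
    _ ≤ _ := hsum2
    _ ≤ _ := hsum
    _ ≤ _ := hN

end AlmostAdditive

/-! ### Limits of the lower and upper bounds -/

section Asymptotics

theorem tendsto_log_natCast : Tendsto (fun N : ℕ => Real.log N) atTop atTop :=
  Real.tendsto_log_atTop.comp tendsto_natCast_atTop_atTop

theorem tendsto_log_div_natCast : Tendsto (fun N : ℕ => Real.log N / N) atTop (𝓝 0) :=
  (Real.isLittleO_log_id_atTop.tendsto_div_nhds_zero).comp tendsto_natCast_atTop_atTop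

theorem natLog_mul_log_two_le {N : ℕ} (hN : N ≠ 0) : Nat.log 2 N * Real.log 2 ≤ Real.log N := by
  rw [← Real.log_pow]
  refine Real.log_le_log (by positivity) ?_
  exact_mod_cast Nat.pow_log_le_self 2 hN

theorem log_le_natLog_add_one_mul {N : ℕ} (hN : N ≠ 0) :
    Real.log N ≤ (Nat.log 2 N + 1) * Real.log 2 := by
  have : ((Nat.log 2 N + 1 : ℕ) : ℝ) * Real.log 2 = Real.log (2 ^ (Nat.log 2 N + 1)) := by
    rw [Real.log_pow]
  push_cast at this
  rw [this]
  refine Real.log_le_log (by positivity) ?_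
  exact_mod_cast (Nat.lt_pow_succ_log_self one_lt_two N).le

theorem tendsto_natLog_div_log :
    Tendsto (fun N : ℕ => (Nat.log 2 N : ℝ) / Real.log N) atTop (𝓝 (1 / Real.log 2)) := by
  have hl2 : 0 < Real.log 2 := Real.log_pos one_lt_two
  have hlow : Tendsto (fun N : ℕ => 1 / Real.log 2 - 1 / Real.log N) atTop
      (𝓝 (1 / Real.log 2)) := by
    simpa using (tendsto_const_nhds (x := 1 / Real.log 2)).sub
      ((tendsto_const_nhds (x := (1 : ℝ))).div_atTop tendsto_log_natCast)
  refine tendsto_of_tendsto_of_tendsto_of_le_of_le' hlow tendsto_const_nhds ?_ ?_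
  · filter_upwards [eventually_ge_atTop 2] with N hN
    have hlN : 0 < Real.log N := Real.log_pos (by exact_mod_cast hN)
    have := log_le_natLog_add_one_mul (N := N) (by omega)
    rw [div_sub_div _ _ hl2.ne' hlN.ne', div_le_div_iff₀ (by positivity) hlN]
    nlinarith
  · filter_upwards [eventually_ge_atTop 2] with N hN
    have hlN : 0 < Real.log N := Real.log_pos (by exact_mod_cast hN)
    have := natLog_mul_log_two_le (N := N) (by omega)
    rw [div_le_div_iff₀ hlN hl2]
    linarith

theorem tendsto_natLog : Tendsto (Nat.log 2) atTop atTop := by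
  refine tendsto_atTop_atTop.2 fun b => ⟨2 ^ b, fun n hn => ?_⟩
  exact (Nat.le_log_iff_pow_le one_lt_two (by have := Nat.one_le_two_pow (n := b); omega)).2 hn

/-- The lower bound on the estimator obtained from words of cost `θ j`, `j = ⌊log₂ N⌋`,
converges. -/
theorem tendsto_lower {u : ℕ → ℝ} {h : ℝ} (hu : Tendsto u atTop (𝓝 h)) {K : ℝ → ℝ}
    (hK : K =o[atTop] fun θ : ℝ => θ) (C : ℝ) {δ : ℝ} (hδ : 0 < δ) :
    Tendsto (fun N : ℕ => u N * (Real.log N / (Nat.log 2 N * (Real.log 2 + 2 * δ) + C +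
        2 * K (Nat.log 2 N * (Real.log 2 + 2 * δ)))) -
        (1 + 2 ^ Nat.log 2 N * Real.exp (-δ * Nat.log 2 N)) * (Real.log N / N)) atTop
      (𝓝 (h * (1 + 2 * δ / Real.log 2)⁻¹)) := by
  have hl2 : 0 < Real.log 2 := Real.log_pos one_lt_two
  set θ : ℕ → ℝ := fun N => Nat.log 2 N * (Real.log 2 + 2 * δ) with hθ
  have h1 : Tendsto (fun N : ℕ => θ N / Real.log N) atTop (𝓝 (1 + 2 * δ / Real.log 2)) := by
    have := tendsto_natLog_div_log.mul_const (Real.log 2 + 2 * δ)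
    rw [show 1 / Real.log 2 * (Real.log 2 + 2 * δ) = 1 + 2 * δ / Real.log 2 by field_simp] at this
    refine this.congr fun N => ?_
    simp only [hθ]
    ring
  have hθtop : Tendsto θ atTop atTop :=
    (tendsto_natCast_atTop_atTop.comp tendsto_natLog).atTop_mul_const (by positivity)
  have h2 : Tendsto (fun N : ℕ => K (θ N) / Real.log N) atTop (𝓝 0) := by
    have h3 : (fun N => K (θ N)) =o[atTop] θ := hK.comp_tendsto hθtop
    have h4 := h3.tendsto_div_nhds_zero.mul h1
    rw [zero_mul] at h4
    refine h4.congr' ?_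
    filter_upwards [hθtop.eventually_gt_atTop 0] with N hN
    field_simp
  have h5 : Tendsto (fun N : ℕ => (θ N + C + 2 * K (θ N)) / Real.log N) atTop
      (𝓝 (1 + 2 * δ / Real.log 2)) := by
    have := (h1.add ((tendsto_const_nhds (x := C)).div_atTop tendsto_log_natCast)).add
      (h2.const_mul 2)
    rw [mul_zero, add_zero, add_zero] at this
    refine this.congr fun N => ?_
    ring
  have h6 := h5.inv₀ (by positivity)
  have h7 : Tendsto (fun N : ℕ => (1 + 2 ^ Nat.log 2 N * Real.exp (-δ * Nat.log 2 N)) *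
      (Real.log N / N)) atTop (𝓝 0) := by
    -- With j = ⌊log₂ N⌋, the bounds 2^j ≤ N and ln N ≤ (j + 1) ln 2 reduce the contribution of the
    -- exceptional words to this sequence.
    have h8 : Tendsto (fun j : ℕ => Real.exp (-δ * j) * ((j + 1) * Real.log 2)) atTop (𝓝 0) := by
      have e1 := (Real.summable_pow_mul_exp_neg_nat_mul 1 hδ).tendsto_atTop_zero
      have e2 := (Real.summable_pow_mul_exp_neg_nat_mul 0 hδ).tendsto_atTop_zero
      have e3 := (e1.add e2).mul_const (Real.log 2)
      rw [add_zero, zero_mul] at e3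
      refine e3.congr fun j => ?_
      ring
    have h9 := tendsto_log_div_natCast.add (h8.comp tendsto_natLog)
    rw [add_zero] at h9
    refine tendsto_of_tendsto_of_tendsto_of_le_of_le' tendsto_const_nhds h9 ?_ ?_
    · exact Eventually.of_forall fun N => by
        have := Real.log_natCast_nonneg N
        positivity
    · filter_upwards [eventually_ge_atTop 1] with N hN
      have hN0 : (0 : ℝ) < N := by exact_mod_cast hN
      have e1 : (2 : ℝ) ^ Nat.log 2 N ≤ N := by
        exact_mod_cast Nat.pow_log_le_self 2 (by omega)
      have e2 := log_le_natLog_add_one_mul (N := N) (by omega)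
      have e3 := Real.log_natCast_nonneg N
      have e4 := Real.exp_nonneg (-δ * Nat.log 2 N)
      rw [add_mul, one_mul, Function.comp]
      refine add_le_add le_rfl ?_
      calc 2 ^ Nat.log 2 N * Real.exp (-δ * Nat.log 2 N) * (Real.log N / N)
          ≤ N * Real.exp (-δ * Nat.log 2 N) * (Real.log N / N) := by gcongr
        _ = Real.exp (-δ * Nat.log 2 N) * Real.log N := by field_simp
        _ ≤ _ := by gcongr
  have h10 := (hu.mul h6).sub h7
  rw [sub_zero] at h10
  refine h10.congr fun N => ?_
  rw [inv_div]

theorem tendsto_upper {u : ℕ → ℝ} {h : ℝ} (hu : Tendsto u atTop (𝓝 h)) {K : ℝ → ℝ}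
    (hK : K =o[atTop] fun θ : ℝ => θ) (C : ℝ) {δ : ℝ} (hδ : δ < 1) :
    Tendsto (fun N : ℕ => u N * (Real.log N / ((1 - δ) * Real.log N - C -
        2 * K ((1 - δ) * Real.log N))) + Real.log N / N) atTop (𝓝 (h * (1 - δ)⁻¹)) := by
  have hδ' : 0 < 1 - δ := by linarith
  have htop : Tendsto (fun N : ℕ => (1 - δ) * Real.log N) atTop atTop :=
    tendsto_log_natCast.const_mul_atTop hδ'
  have h2 : Tendsto (fun N : ℕ => K ((1 - δ) * Real.log N) / Real.log N) atTop (𝓝 0) := by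
    have h4 := (hK.comp_tendsto htop).tendsto_div_nhds_zero.mul_const (1 - δ)
    rw [zero_mul] at h4
    refine h4.congr' ?_
    filter_upwards [tendsto_log_natCast.eventually_gt_atTop 0] with N hN
    simp only [Function.comp]
    field_simp
  have h5 : Tendsto (fun N : ℕ => ((1 - δ) * Real.log N - C - 2 * K ((1 - δ) * Real.log N)) /
      Real.log N) atTop (𝓝 (1 - δ)) := by
    have := ((tendsto_const_nhds (x := 1 - δ)).sub
      ((tendsto_const_nhds (x := C)).div_atTop tendsto_log_natCast)).sub (h2.const_mul 2)
    rw [mul_zero, sub_zero, sub_zero] at this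
    refine this.congr' ?_
    filter_upwards [tendsto_log_natCast.eventually_gt_atTop 0] with N hN
    field_simp
  have h10 := (hu.mul (h5.inv₀ hδ'.ne')).add tendsto_log_div_natCast
  rw [add_zero] at h10
  refine h10.congr fun N => ?_
  rw [inv_div]

theorem eventually_upper_pos {K : ℝ → ℝ} (hK : K =o[atTop] fun θ : ℝ => θ) (C : ℝ) :
    ∀ᶠ θ : ℝ in atTop, 0 < θ - C - 2 * K θ := by
  filter_upwards [hK.bound (show (0 : ℝ) < 1 / 4 by norm_num), eventually_gt_atTop (2 * |C|)]
    with θ h1 h2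
  have h3 : 0 < θ := lt_of_le_of_lt (by positivity) h2
  rw [Real.norm_eq_abs, Real.norm_of_nonneg h3.le] at h1
  linarith [le_abs_self C, le_abs_self (K θ)]

end Asymptotics

/-! ### Words, cylinders and their costs -/

section Words

variable {A : Type*}

/-- The word formed by the `n` letters of `y` that follow its first `i` letters. -/
def word (y : ℕ → A) (i n : ℕ) : Fin n → A := fun j => y (i + j)

theorem append_word (y : ℕ → A) (i n m : ℕ) :
    Fin.append (word y i n) (word y (i + n) m) = word y i (n + m) := by
  funext j
  induction j using Fin.addCases with
  | left j => simp [word]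
  | right j => simp [word, add_assoc]

theorem iterate_shift_apply (r : ℕ) (x : ℕ → A) (j : ℕ) : shift^[r] x j = x (r + j) := by
  induction r generalizing x with
  | zero => simp
  | succ r ih =>
    rw [Function.iterate_succ_apply, ih, shift]
    congr 1
    omega

theorem word_iterate_shift (r : ℕ) (y : ℕ → A) (i n : ℕ) :
    word (shift^[r] y) i n = word y (r + i) n := by
  funext j
  simp only [word, iterate_shift_apply, add_assoc]

theorem iterate_shift_mem_cyl_word {x y : ℕ → A} {r i n : ℕ} :
    shift^[r] x ∈ cyl (word y i n) ↔ ∀ j < n, x (r + j) = y (i + j) := by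
  change (∀ j : Fin n, shift^[r] x j = y (i + j)) ↔ _
  simp only [iterate_shift_apply]
  exact ⟨fun h j hj => h ⟨j, hj⟩, fun h j => h j j.2⟩

theorem mem_cyl_word {x y : ℕ → A} {i n : ℕ} :
    x ∈ cyl (word y i n) ↔ ∀ j < n, x j = y (i + j) := by
  simpa using iterate_shift_mem_cyl_word (x := x) (y := y) (r := 0) (i := i) (n := n)

/-- The last admissible starting point is `N - l` counted from 0, which is a waiting time of `N - l
+ 1`. -/
theorem not_occursIn_subset {N i l : ℕ} (hl : l ≤ N) :
    {x | ¬OccursIn x y N i l} ⊆ {x | ((N - l + 2 : ℕ) : ℕ∞) ≤ waitingTime (word y i l) x} := by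
  intro x hx
  change _ ≤ waitingTime _ x
  unfold waitingTime
  refine le_iInf₂ fun r hr => ?_
  by_contra hlt
  have hlt : r + 1 < N - l + 2 := by exact_mod_cast not_le.1 hlt
  exact hx ⟨r, by omega, fun j hj => hr ⟨j, hj⟩⟩

variable [MeasurableSpace A]

variable {P : Measure (ℕ → A)}

/-- The cost, minus the logarithm of the probability, of the words of `y`. -/
noncomputable def cost (P : Measure (ℕ → A)) (y : ℕ → A) (i n : ℕ) : ℝ :=
  -Real.log (P.real (cyl (word y i n)))

theorem exp_neg_cost {y : ℕ → A} {i n : ℕ} (h : 0 < P.real (cyl (word y i n))) :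
    Real.exp (-cost P y i n) = P.real (cyl (word y i n)) := by
  rw [cost, neg_neg, Real.exp_log h]

theorem exists_mul_le_cost [IsFiniteMeasure P] (hFE : FastDecay P) :
    ∃ (γ : ℝ) (n₀ : ℕ), 0 < γ ∧ ∀ y : ℕ → A, (∀ i n, 0 < P.real (cyl (word y i n))) →
      ∀ i, ∀ n ≥ n₀, γ * n ≤ cost P y i n := by
  obtain ⟨γ, hγ, h⟩ := hFE
  obtain ⟨n₀, hn₀⟩ := eventually_atTop.1 h
  refine ⟨-γ, n₀, by linarith, fun y hy i n hn => ?_⟩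
  have h1 := hn₀ n hn (word y i n) ((ENNReal.toReal_pos_iff.1 (hy i n)).1)
  rw [← Real.log_le_iff_le_exp (hy i n)] at h1
  rw [cost]
  linarith

variable [MeasurableSingletonClass A]

theorem measurableSet_cyl {n : ℕ} (a : Fin n → A) : MeasurableSet (cyl a) := by
  have : cyl a = ⋂ i : Fin n, (fun x : ℕ → A => x i) ⁻¹' {a i} := by
    ext x
    simp [cyl]
  rw [this]
  exact MeasurableSet.iInter fun i => measurable_pi_apply _ (measurableSet_singleton _)

theorem measurableSet_occursIn (y : ℕ → A) (N i l : ℕ) :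
    MeasurableSet {x | OccursIn x y N i l} := by
  have : {x | OccursIn x y N i l} =
      ⋃ r : ℕ, ⋃ _ : r + l ≤ N, ⋂ j : ℕ, ⋂ _ : j < l, (fun x : ℕ → A => x (r + j)) ⁻¹' {y (i + j)} := by
    ext x
    simp [OccursIn]
  rw [this]
  exact MeasurableSet.iUnion fun r => MeasurableSet.iUnion fun _ => MeasurableSet.iInter fun j =>
    MeasurableSet.iInter fun _ => measurable_pi_apply _ (measurableSet_singleton _)

theorem measureReal_iterate_shift_preimage_cyl (hP : MeasurePreserving shift P P) (r : ℕ) {n : ℕ}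
    (a : Fin n → A) : P.real (shift^[r] ⁻¹' cyl a) = P.real (cyl a) := by
  rw [measureReal_def, measureReal_def,
    (hP.iterate r).measure_preimage (measurableSet_cyl a).nullMeasurableSet]

theorem measureReal_cyl_word_le [IsFiniteMeasure P] (hP : MeasurePreserving shift P P)
    (y : ℕ → A) {i n i' n' : ℕ} (hi : i' ≤ i) (hn : i + n ≤ i' + n') :
    P.real (cyl (word y i' n')) ≤ P.real (cyl (word y i n)) := by
  rw [← measureReal_iterate_shift_preimage_cyl hP (i - i') (word y i n)]
  refine measureReal_mono fun x hx => ?_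
  rw [Set.mem_preimage, iterate_shift_mem_cyl_word]
  intro j hj
  rw [mem_cyl_word.1 hx _ (by omega)]
  congr 1
  omega

/-- Union bound over the starting points, fewer than `N + 1` because `l` is positive, and
stationarity. -/
theorem measureReal_occursIn_le [IsFiniteMeasure P] (hP : MeasurePreserving shift P P)
    (y : ℕ → A) (N i : ℕ) {l : ℕ} (hl : 1 ≤ l) :
    P.real {x | OccursIn x y N i l} ≤ N * P.real (cyl (word y i l)) := by
  have hsub : {x | OccursIn x y N i l} ⊆
      ⋃ r ∈ Finset.range N, shift^[r] ⁻¹' cyl (word y i l) := by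
    rintro x ⟨r, hr, h⟩
    simp only [Set.mem_iUnion, Finset.mem_range, Set.mem_preimage]
    exact ⟨r, by omega, iterate_shift_mem_cyl_word.2 h⟩
  refine (measureReal_mono hsub (measure_ne_top _ _)).trans ((measureReal_biUnion_finset_le _ _).trans ?_)
  simp [measureReal_iterate_shift_preimage_cyl hP]

theorem exists_almostAdditive [Finite A] [IsProbabilityMeasure P]
    (hP : MeasurePreserving shift P P) (hID : ImmediatelyDecoupled P) :
    ∃ (k : ℕ → ℝ) (C : ℝ), k =o[atTop] (fun n : ℕ => (n : ℝ)) ∧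
      ∀ y : ℕ → A, (∀ i n, 0 < P.real (cyl (word y i n))) → AlmostAdditive (cost P y) k C := by
  obtain ⟨k, hkm, hko, hk⟩ := hID
  have hfin : BddAbove (Set.range fun a : Fin 1 → A => -Real.log (P.real (cyl a))) :=
    (Set.finite_range _).bddAbove
  obtain ⟨C, hC⟩ := hfin
  have hko' : (fun n => max (k n) 0) =o[atTop] (fun n : ℕ => (n : ℝ)) := by
    refine (IsBigO.of_bound 1 (Eventually.of_forall fun n => ?_)).trans_isLittleO hko
    rw [Real.norm_of_nonneg (le_max_right _ _), one_mul, Real.norm_eq_abs]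
    exact max_le (le_abs_self _) (abs_nonneg _)
  -- The error is made nonnegative, which also covers empty words; `C` bounds the cost of a letter
  -- of the finite alphabet. Neither depends on `y`.
  refine ⟨fun n => max (k n) 0, C + max (k 1) 0, hko', fun y hy => ?_⟩
  have h0 (i : ℕ) : cost P y i 0 = 0 := by
    have : cyl (word y i 0) = Set.univ := by
      ext x; simp [cyl]
    simp [cost, this]
  have key (i n m : ℕ) (hn : 1 ≤ n) (hm : 1 ≤ m) :
      cost P y i n + cost P y (i + n) m ≤ cost P y i (n + m) + k n ∧
      cost P y i (n + m) ≤ cost P y i n + cost P y (i + n) m + k n := by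
    have hs (i n : ℕ) : word y i n ∈ suppWords P n :=
      (ENNReal.toReal_pos_iff.1 (hy i n)).1
    obtain ⟨h1, h2⟩ := hk n m hn hm _ (hs i n) _ (hs (i + n) m)
    rw [append_word] at h1 h2
    have h2 := h2 (hs i (n + m))
    have hpos := div_pos (hy i (n + m)) (mul_pos (hy i n) (hy (i + n) m))
    rw [← Real.log_le_iff_le_exp hpos] at h1
    rw [← Real.le_log_iff_exp_le hpos] at h2
    rw [Real.log_div (hy _ _).ne' (mul_pos (hy i n) (hy (i + n) m)).ne',
      Real.log_mul (hy _ _).ne' (hy _ _).ne'] at h1 h2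
    simp only [cost]
    constructor <;> linarith
  refine ⟨fun a b hab => max_le_max (hkm hab) le_rfl, fun n => le_max_right _ _, h0, ?_, ?_, ?_, ?_⟩
  · intro i n i' n' hi hn
    exact neg_le_neg (Real.log_le_log (hy _ _) (measureReal_cyl_word_le hP y hi hn))
  · intro i n m
    have hmax := le_max_left (k n) 0
    have hmax' := le_max_right (k n) 0
    rcases Nat.eq_zero_or_pos n with rfl | hn
    · simp [h0]
    rcases Nat.eq_zero_or_pos m with rfl | hm
    · simp [h0]
    linarith [(key i n m hn hm).1]
  · intro i n m
    have hmax := le_max_left (k n) 0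
    rcases Nat.eq_zero_or_pos n with rfl | hn
    · simp [h0]
    rcases Nat.eq_zero_or_pos m with rfl | hm
    · simp [h0]
    linarith [(key i n m hn hm).2]
  · intro i
    have : cost P y i 1 ≤ C := hC ⟨word y i 1, rfl⟩
    simpa using this

end Words

/-! ### Almost sure bounds on the estimator for fixed `y` -/

theorem ae_eventually_notMem_of_summable {Ω : Type*} [MeasurableSpace Ω] {μ : Measure Ω}
    [IsFiniteMeasure μ] {s : ℕ → Set Ω} {f : ℕ → ℝ} (hf : Summable f)
    (hs : ∀ᶠ n in atTop, μ.real (s n) ≤ f n) : ∀ᵐ x ∂μ, ∀ᶠ n in atTop, x ∉ s n := by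
  obtain ⟨n₀, hn₀⟩ := eventually_atTop.1 hs
  have hne : ∑' n, μ (s (n + n₀)) ≠ ∞ := by
    refine ne_top_of_le_ne_top ((summable_nat_add_iff n₀).2 hf).tsum_ofReal_ne_top
      (ENNReal.tsum_le_tsum fun n => ?_)
    rw [← ofReal_measureReal]
    exact ENNReal.ofReal_le_ofReal (hn₀ _ (by omega))
  filter_upwards [ae_eventually_notMem hne] with x hx
  rwa [← map_add_atTop_eq_nat n₀, eventually_map]

section AlmostSure

variable {A : Type*} [MeasurableSpace A] [MeasurableSingletonClass A] {P : Measure (ℕ → A)}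
  {k : ℕ → ℝ} {C γ h δ : ℝ} {n₀ : ℕ} {y : ℕ → A}

open Classical in
/-- The positions `i < M` at which the word of `y` of cost at least `θ` occurs in `x`. -/
noncomputable def occurringPositions (P : Measure (ℕ → A)) (θ : ℝ) (y x : ℕ → A) (M : ℕ) :
    Finset ℕ :=
  (Finset.range M).filter fun i => OccursIn x y M i (firstLength (cost P y) θ i)

/-- Markov's inequality: each of the `M` positions contributes at most `M * exp (-θ)` to the
expected number, so no independence is needed. -/
theorem measureReal_le_card_occurringPositions [IsFiniteMeasure P]
    (hP : MeasurePreserving shift P P) (hy : ∀ i n, 0 < P.real (cyl (word y i n)))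
    (hAA : AlmostAdditive (cost P y) k C) (hγ : 0 < γ)
    (hF : ∀ i, ∀ n ≥ n₀, γ * n ≤ cost P y i n) {θ : ℝ} (hθ : 0 < θ) (M : ℕ) {β : ℝ}
    (hβ : 0 < β) :
    P.real {x | β ≤ (occurringPositions P θ y x M).card} ≤ M * (M * Real.exp (-θ)) / β := by
  classical
  set S : ℕ → Set (ℕ → A) := fun i => {x | OccursIn x y M i (firstLength (cost P y) θ i)}
  have hS (i : ℕ) : MeasurableSet (S i) := measurableSet_occursIn y M i _
  have hSle (i : ℕ) : P.real (S i) ≤ M * Real.exp (-θ) := by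
    refine (measureReal_occursIn_le hP y M i (hAA.one_le_firstLength hγ hF hθ i)).trans ?_
    rw [← exp_neg_cost (hy _ _)]
    have := AlmostAdditive.le_firstLength (θ := θ) hγ hF i
    gcongr
  have hcard (x : ℕ → A) : ((occurringPositions P θ y x M).card : ℝ) =
      ∑ i ∈ Finset.range M, (S i).indicator (fun _ => (1 : ℝ)) x := by
    rw [occurringPositions, Finset.card_filter]
    push_cast
    exact Finset.sum_congr rfl fun i _ => by simp [S, Set.indicator_apply]
  have hint (i : ℕ) : Integrable ((S i).indicator fun _ => (1 : ℝ)) P :=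
    (integrable_const _).indicator (hS i)
  have hmarkov := mul_meas_ge_le_integral_of_nonneg (μ := P)
    (f := fun x => ((occurringPositions P θ y x M).card : ℝ))
    (Eventually.of_forall fun x => Nat.cast_nonneg _)
    (by simp_rw [hcard]; exact integrable_finsetSum _ fun i _ => hint i) β
  simp_rw [hcard] at hmarkov
  rw [integral_finsetSum _ fun i _ => hint i] at hmarkov
  have hsum : ∑ i ∈ Finset.range M, ∫ x, (S i).indicator (fun _ => (1 : ℝ)) x ∂P ≤
      M * (M * Real.exp (-θ)) := by
    refine (Finset.sum_le_sum (g := fun _ => M * Real.exp (-θ)) fun i _ => ?_).trans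
      (by simp)
    rw [integral_indicator (hS i)]
    simpa using hSle i
  simp_rw [hcard]
  rw [le_div_iff₀ hβ, mul_comm]
  exact hmarkov.trans hsum

/-- The estimator is asymptotically at least the cost rate. -/
theorem ae_eventually_le_zmEstimator [IsFiniteMeasure P]
    (hP : MeasurePreserving shift P P) (hy : ∀ i n, 0 < P.real (cyl (word y i n)))
    (hAA : AlmostAdditive (cost P y) k C) (hk : k =o[atTop] fun n : ℕ => (n : ℝ)) (hγ : 0 < γ)
    (hF : ∀ i, ∀ n ≥ n₀, γ * n ≤ cost P y i n)
    (hh : Tendsto (fun n : ℕ => cost P y 0 n / n) atTop (𝓝 h)) (hδ : 0 < δ) :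
    ∀ᵐ x ∂P, ∃ v : ℕ → ℝ, Tendsto v atTop (𝓝 (h * (1 + 2 * δ / Real.log 2)⁻¹)) ∧
      ∀ᶠ N in atTop, v N ≤ zmEstimator y x N := by
  have hl2 : 0 < Real.log 2 := Real.log_pos one_lt_two
  -- For M = 2^(j+1) the expected number of occurring words is at most 4 · 2^j e^{-2δj}, so it
  -- exceeds 2^j e^{-δj} with probability at most 4 e^{-δj}. This is summable over dyadic scales;
  -- the same bound for each N would be a small negative power of N.
  set θ : ℕ → ℝ := fun j => j * (Real.log 2 + 2 * δ) with hθ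
  have hbad : ∀ᵐ x ∂P, ∀ᶠ j : ℕ in atTop, x ∉ {x | (2 : ℝ) ^ j * Real.exp (-δ * j) ≤
      (occurringPositions P (θ j) y x (2 ^ (j + 1))).card} := by
    refine ae_eventually_notMem_of_summable (f := fun j : ℕ => 4 * Real.exp (-δ * j)) ?_ ?_
    · simpa using (Real.summable_pow_mul_exp_neg_nat_mul 0 hδ).mul_left 4
    · filter_upwards [eventually_ge_atTop 1] with j hj
      have hj' : (0 : ℝ) < j := by exact_mod_cast hj
      refine (measureReal_le_card_occurringPositions hP hy hAA hγ hF (θ := θ j) (by positivity) _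
        (by positivity)).trans_eq ?_
      have e1 : Real.exp (-θ j) = ((2 : ℝ) ^ j)⁻¹ * Real.exp (-δ * j) * Real.exp (-δ * j) := by
        have e2 : (2 : ℝ) ^ j = Real.exp (j * Real.log 2) := by
          rw [mul_comm, Real.exp_mul, Real.exp_log two_pos, Real.rpow_natCast]
        rw [e2, ← Real.exp_neg, ← Real.exp_add, ← Real.exp_add]
        congr 1
        simp only [hθ]
        ring
      rw [e1]
      push_cast
      have e3 := Real.exp_pos (-δ * j)
      rw [pow_succ]
      field_simp
      ring
  filter_upwards [hbad] with x hx
  refine ⟨_, tendsto_lower hh (isLittleO_comp_maxLength (n₀ := n₀) hk hγ) C hδ, ?_⟩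
  filter_upwards [tendsto_natLog.eventually hx, tendsto_natLog.eventually_ge_atTop 1,
    eventually_ge_atTop 1] with N hN hj hN1
  set j := Nat.log 2 N with hjdef
  simp only [not_le] at hN
  have hj' : (0 : ℝ) < j := by exact_mod_cast hj
  have hθ0 : 0 < θ j := by positivity
  have hlt := hAA.le_parsingCount_mul hγ hF hθ0 (x := x) (y := y) (N := N) (M := 2 ^ (j + 1))
    (Nat.lt_pow_succ_log_self one_lt_two N).le (occurringPositions P (θ j) y x (2 ^ (j + 1)))
    fun i hi hocc => by simp [occurringPositions, hi, hocc]
  have hD : 0 < θ j + C + 2 * k (maxLength n₀ γ (θ j)) := by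
    linarith [hAA.const_nonneg, hAA.error_nonneg (maxLength n₀ γ (θ j))]
  rw [← div_le_iff₀ hD] at hlt
  have hN0 : (0 : ℝ) < N := by exact_mod_cast hN1
  have hlog : 0 ≤ Real.log N / N := div_nonneg (Real.log_natCast_nonneg N) hN0.le
  have h1 : cost P y 0 N / (θ j + C + 2 * k (maxLength n₀ γ (θ j))) -
      (1 + 2 ^ j * Real.exp (-δ * j)) ≤ parsingCount y x N := by linarith
  have h2 := mul_le_mul_of_nonneg_right h1 hlog
  rw [zmEstimator]
  calc _ = _ := ?_
    _ ≤ _ := h2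
    _ = _ := by ring
  rw [sub_mul]
  congr 1
  simp only [hθ]
  ring

/-- An affine bound valid for all `n` is needed because the words to which (KB) is applied may also
be short. -/
theorem exists_abs_le_of_isLittleO {a : ℕ → ℝ} (ha : a =o[atTop] fun n : ℕ => (n : ℝ)) {η : ℝ}
    (hη : 0 < η) : ∃ D, ∀ n, |a n| ≤ η * n + D := by
  obtain ⟨n₁, hn₁⟩ := eventually_atTop.1 (ha.bound hη)
  refine ⟨∑ i ∈ Finset.range n₁, |a i|, fun n => ?_⟩
  rcases le_or_gt n₁ n with h | h
  · have := hn₁ n h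
    rw [Real.norm_eq_abs, Real.norm_of_nonneg (Nat.cast_nonneg n)] at this
    have h2 : 0 ≤ ∑ i ∈ Finset.range n₁, |a i| := Finset.sum_nonneg fun i _ => abs_nonneg _
    linarith
  · have := Finset.single_le_sum (f := fun i => |a i|) (fun i _ => abs_nonneg _)
      (Finset.mem_range.2 h)
    have h2 : 0 ≤ η * n := by positivity
    linarith

theorem eventually_linear_le_exp (a b : ℝ) {η : ℝ} (hη : 0 < η) :
    ∀ᶠ u : ℝ in atTop, a * u + b ≤ Real.exp (η * u) := by
  have h1 := (isLittleO_pow_exp_pos_mul_atTop 1 hη).bound (show 0 < 1 / (2 * (|a| + 1)) by positivity)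
  have h2 : Tendsto (fun u => Real.exp (η * u)) atTop atTop :=
    Real.tendsto_exp_atTop.comp (tendsto_id.const_mul_atTop hη)
  filter_upwards [h1, h2.eventually_ge_atTop (2 * b), eventually_ge_atTop 0] with u h3 h4 h5
  rw [pow_one, Real.norm_of_nonneg h5, Real.norm_of_nonneg (Real.exp_nonneg _),
    div_mul_eq_mul_div, one_mul, le_div_iff₀ (by positivity)] at h3
  have h6 : a * u ≤ |a| * u := by gcongr; exact le_abs_self a
  linarith

/-- For l = O(ln N), the factor e^{-k'_l} is at least a constant times N^{-δ/4} and the floor is at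
least N^{1-δ/4}. Together with N^{-(1-δ)} this leaves a constant times N^{δ/2}, which beats 3 ln N.
The 3 makes the failure probability N^{-3}, hence N^{-2} after a union over `N` positions, which is
summable. -/
theorem eventually_le_waiting_exponent {k' τ : ℕ → ℝ} (hk' : k' =o[atTop] fun n : ℕ => (n : ℝ))
    (hτ : τ =o[atTop] fun n : ℕ => (n : ℝ)) (hpos : ∀ l : ℕ, 1 ≤ l → 0 < (l : ℝ) + τ l)
    (hγ : 0 < γ) (hδ : 0 < δ) (hδ1 : δ < 1) (n₀ : ℕ) :
    ∀ᶠ N : ℕ in atTop, ∀ l : ℕ, 1 ≤ l → l ≤ maxLength n₀ γ ((1 - δ) * Real.log N) →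
      l ≤ N ∧ 3 * Real.log N ≤ Real.exp (-k' l) * Real.exp (-((1 - δ) * Real.log N)) *
        (⌊(((N - l + 2 : ℕ) : ℝ) - 1) / (l + τ l)⌋ : ℝ) := by
  obtain ⟨D₁, hD₁⟩ := exists_abs_le_of_isLittleO hk' (show 0 < δ * γ / 4 by positivity)
  obtain ⟨D₂, hD₂⟩ := exists_abs_le_of_isLittleO hτ one_pos
  set D₁' := δ * γ / 4 * (n₀ + 1) + D₁ with hD₁'
  have ev1 := eventually_linear_le_exp (2 * (1 / γ)) (2 * (n₀ + 1)) one_pos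
  have ev2 := eventually_linear_le_exp (4 * (2 / γ)) (4 * (2 * (n₀ + 1) + D₂))
    (show 0 < δ / 4 by positivity)
  have ev3 := eventually_linear_le_exp (3 * Real.exp D₁') 0 (show 0 < δ / 2 by positivity)
  filter_upwards [tendsto_log_natCast.eventually ev1, tendsto_log_natCast.eventually ev2,
    tendsto_log_natCast.eventually ev3, eventually_ge_atTop 1] with N h1 h2 h3 hN l hl hlm
  have hN0 : (0 : ℝ) < N := by exact_mod_cast hN
  have hu : 0 ≤ Real.log N := Real.log_natCast_nonneg N
  have hNexp : Real.exp (Real.log N) = N := Real.exp_log hN0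
  set u := Real.log N with hu_def
  have hlR : (l : ℝ) ≤ n₀ + 1 + u / γ := by
    have e1 : (l : ℝ) ≤ maxLength n₀ γ ((1 - δ) * u) := by exact_mod_cast hlm
    have e2 := maxLength_le (n₀ := n₀) hγ (mul_nonneg (by linarith) hu : 0 ≤ (1 - δ) * u)
    have e3 : (1 - δ) * u / γ ≤ u / γ := by gcongr; nlinarith
    linarith
  have hlN2 : 2 * (l : ℝ) ≤ N := by
    rw [one_mul, hNexp] at h1
    have : u / γ = 1 / γ * u := by ring
    linarith
  have hlN : l ≤ N := by
    have : (l : ℝ) ≤ N := by linarith [(Nat.cast_nonneg l : (0 : ℝ) ≤ l)]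
    exact_mod_cast this
  refine ⟨hlN, ?_⟩
  have hk'l : k' l ≤ δ / 4 * u + D₁' := by
    have e1 := (le_abs_self _).trans (hD₁ l)
    have e2 : δ * γ / 4 * l ≤ δ * γ / 4 * (n₀ + 1 + u / γ) := by gcongr
    have e3 : δ * γ / 4 * (u / γ) = δ / 4 * u := by field_simp
    rw [mul_add, e3] at e2
    linarith
  have hden : 4 * ((l : ℝ) + τ l) ≤ Real.exp (δ / 4 * u) := by
    have e1 := (le_abs_self _).trans (hD₂ l)
    have : u / γ = 1 / γ * u := by ring
    have : 4 * (2 / γ) * u = 8 * (u / γ) := by ring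
    linarith
  have hfloor : Real.exp (u - δ / 4 * u) ≤
      (⌊(((N - l + 2 : ℕ) : ℝ) - 1) / (l + τ l)⌋ : ℝ) := by
    -- The numerator is at least N/2 and the denominator at most N^{δ/4}/4; the factor 2 pays for
    -- the loss of 1 in the floor.
    have e1 : 2 * Real.exp (u - δ / 4 * u) ≤ (((N - l + 2 : ℕ) : ℝ) - 1) / (l + τ l) := by
      rw [le_div_iff₀ (hpos l hl)]
      push_cast [Nat.cast_sub hlN]
      have e2 : Real.exp (u - δ / 4 * u) * Real.exp (δ / 4 * u) = N := by
        rw [← Real.exp_add, sub_add_cancel, hNexp]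
      have e3 := mul_le_mul_of_nonneg_left hden (Real.exp_nonneg (u - δ / 4 * u))
      rw [e2] at e3
      linarith
    have e4 : 1 ≤ Real.exp (u - δ / 4 * u) := Real.one_le_exp (by nlinarith)
    have e5 := Int.sub_one_lt_floor ((((N - l + 2 : ℕ) : ℝ) - 1) / (l + τ l))
    linarith
  have hexp : 3 * u ≤ Real.exp (δ / 2 * u - D₁') := by
    rw [Real.exp_sub, le_div_iff₀ (Real.exp_pos _)]
    linarith
  calc 3 * u ≤ Real.exp (δ / 2 * u - D₁') := hexp
    _ = Real.exp (-(δ / 4 * u + D₁')) * Real.exp (-((1 - δ) * u)) * Real.exp (u - δ / 4 * u) := by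
      rw [← Real.exp_add, ← Real.exp_add]
      congr 1
      ring
    _ ≤ _ := by gcongr

omit [MeasurableSingletonClass A] in
/-- The estimator is asymptotically at most the cost rate. -/
theorem ae_eventually_zmEstimator_le [IsFiniteMeasure P]
    (hy : ∀ i n, 0 < P.real (cyl (word y i n))) (hKB : KontoyiannisBound P)
    (hAA : AlmostAdditive (cost P y) k C) (hk : k =o[atTop] fun n : ℕ => (n : ℝ)) (hγ : 0 < γ)
    (hF : ∀ i, ∀ n ≥ n₀, γ * n ≤ cost P y i n)
    (hh : Tendsto (fun n : ℕ => cost P y 0 n / n) atTop (𝓝 h)) (hδ : 0 < δ) (hδ1 : δ < 1) :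
    ∀ᵐ x ∂P, ∃ v : ℕ → ℝ, Tendsto v atTop (𝓝 (h * (1 - δ)⁻¹)) ∧
      ∀ᶠ N in atTop, zmEstimator y x N ≤ v N := by
  obtain ⟨k', τ, hk', hτ, hpos, hbound⟩ := hKB
  set θ : ℕ → ℝ := fun N => (1 - δ) * Real.log N with hθ
  have hθtop : Tendsto θ atTop atTop := tendsto_log_natCast.const_mul_atTop (by linarith)
  have hgood : ∀ᵐ x ∂P, ∀ᶠ N : ℕ in atTop, x ∉ ⋃ i ∈ Finset.range N,
      {x | ¬OccursIn x y N i (firstLength (cost P y) (θ N) i - 1)} := by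
    refine ae_eventually_notMem_of_summable (f := fun N : ℕ => 1 / (N : ℝ) ^ 2)
      (Real.summable_one_div_nat_pow.2 one_lt_two) ?_
    filter_upwards [eventually_le_waiting_exponent hk' hτ hpos hγ hδ hδ1 n₀,
      hθtop.eventually_gt_atTop C, eventually_ge_atTop 1] with N hexp hC hN
    have hN0 : (0 : ℝ) < N := by exact_mod_cast hN
    have hterm (i : ℕ) : P.real {x | ¬OccursIn x y N i (firstLength (cost P y) (θ N) i - 1)} ≤
        Real.exp (-(3 * Real.log N)) := by
      have h2 := hAA.two_le_firstLength hγ hF hC i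
      have hm := AlmostAdditive.firstLength_le_maxLength (θ := θ N) hγ hF i
      set l := firstLength (cost P y) (θ N) i - 1 with hl
      obtain ⟨hlN, h3⟩ := hexp l (by omega) (show l ≤ maxLength n₀ γ (θ N) by omega)
      have hcost : cost P y i l < θ N :=
        AlmostAdditive.lt_of_lt_firstLength (F := cost P y) (θ := θ N) (i := i) (l := l) (by omega)
      refine (measureReal_mono (not_occursIn_subset hlN) (measure_ne_top _ _)).trans
        ((hbound l (by omega) (word y i l) (N - l + 2) (by omega)).trans ?_)
      rw [Real.exp_le_exp, neg_le_neg_iff, ← exp_neg_cost (hy i l)]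
      refine h3.trans ?_
      have hnum : (0 : ℝ) ≤ ((N - l + 2 : ℕ) : ℝ) - 1 := by
        push_cast
        linarith [(Nat.cast_nonneg (N - l) : (0 : ℝ) ≤ _)]
      have hfl : (0 : ℝ) ≤ (⌊(((N - l + 2 : ℕ) : ℝ) - 1) / (l + τ l)⌋ : ℝ) := by
        exact_mod_cast Int.floor_nonneg.2 (div_nonneg hnum (hpos l (by omega)).le)
      have : -((1 - δ) * Real.log N) ≤ -cost P y i l := neg_le_neg hcost.le
      gcongr
    refine (measureReal_biUnion_finset_le _ _).trans
      ((Finset.sum_le_sum fun i _ => hterm i).trans_eq ?_)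
    rw [Finset.sum_const, Finset.card_range, nsmul_eq_mul, Real.exp_neg, mul_comm 3, Real.exp_mul,
      Real.exp_log hN0]
    norm_cast
    push_cast
    field_simp
  filter_upwards [hgood] with x hx
  refine ⟨_, tendsto_upper hh (isLittleO_comp_maxLength (n₀ := n₀) hk hγ) C hδ1, ?_⟩
  filter_upwards [hx, hθtop.eventually_gt_atTop C, eventually_ge_atTop 1,
    hθtop.eventually (eventually_upper_pos (isLittleO_comp_maxLength (n₀ := n₀) hk hγ) C)]
    with N hN hC hN1 hD
  simp only [Set.mem_iUnion, Finset.mem_range, Set.mem_ofPred_eq, not_exists, not_not] at hN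
  have hN0 : (0 : ℝ) < N := by exact_mod_cast hN1
  have hlog : 0 ≤ Real.log N / N := div_nonneg (Real.log_natCast_nonneg N) hN0.le
  have hle := hAA.parsingCount_mul_le hγ hF hC hD.le hN1 hN
  rw [← le_div_iff₀ hD] at hle
  have h1 : (parsingCount y x N : ℝ) ≤
      cost P y 0 N / (θ N - C - 2 * k (maxLength n₀ γ (θ N))) + 1 := by linarith
  have h2 := mul_le_mul_of_nonneg_right h1 hlog
  rw [zmEstimator]
  calc _ = _ := by ring
    _ ≤ _ := h2
    _ = _ := by
      rw [add_mul]
      congr 1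
      · simp only [hθ]
        ring
      · ring

/-- For a sequence `y` with a cost rate, the estimator converges to it almost surely. -/
theorem ae_tendsto_zmEstimator [IsFiniteMeasure P]
    (hP : MeasurePreserving shift P P) (hy : ∀ i n, 0 < P.real (cyl (word y i n)))
    (hKB : KontoyiannisBound P)
    (hAA : AlmostAdditive (cost P y) k C) (hk : k =o[atTop] fun n : ℕ => (n : ℝ)) (hγ : 0 < γ)
    (hF : ∀ i, ∀ n ≥ n₀, γ * n ≤ cost P y i n)
    (hh : Tendsto (fun n : ℕ => cost P y 0 n / n) atTop (𝓝 h)) :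
    ∀ᵐ x ∂P, Tendsto (zmEstimator y x) atTop (𝓝 h) := by
  -- A countable sequence of δ in (0, 1) with limit 0 keeps the exceptional set of `x` null.
  have hδ (m : ℕ) : (0 : ℝ) < 1 / ((m : ℝ) + 2) := by positivity
  have hδ1 (m : ℕ) : 1 / ((m : ℝ) + 2) < 1 := by
    rw [div_lt_one (by positivity)]
    linarith [(Nat.cast_nonneg m : (0 : ℝ) ≤ m)]
  have hlo := ae_all_iff.2 fun m : ℕ => ae_eventually_le_zmEstimator hP hy hAA hk hγ hF hh (hδ m)
  have hup := ae_all_iff.2 fun m : ℕ =>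
    ae_eventually_zmEstimator_le hy hKB hAA hk hγ hF hh (hδ m) (hδ1 m)
  have hδ0 : Tendsto (fun m : ℕ => 1 / ((m : ℝ) + 2)) atTop (𝓝 0) :=
    tendsto_const_nhds.div_atTop (tendsto_atTop_add_const_right _ _ tendsto_natCast_atTop_atTop)
  have hl : Tendsto (fun m : ℕ => h * (1 + 2 * (1 / ((m : ℝ) + 2)) / Real.log 2)⁻¹) atTop
      (𝓝 h) := by
    have := ((((hδ0.const_mul 2).div_const (Real.log 2)).const_add 1).inv₀
      (by simp)).const_mul h
    simpa using this
  have hu : Tendsto (fun m : ℕ => h * (1 - 1 / ((m : ℝ) + 2))⁻¹) atTop (𝓝 h) := by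
    have := ((hδ0.const_sub 1).inv₀ (by simp)).const_mul h
    simpa using this
  filter_upwards [hlo, hup] with x hx1 hx2
  refine tendsto_order.2 ⟨fun a ha => ?_, fun a ha => ?_⟩
  · obtain ⟨m, hm⟩ := (hl.eventually_const_lt ha).exists
    obtain ⟨v, hv, hv'⟩ := hx1 m
    filter_upwards [hv.eventually_const_lt hm, hv'] with N h1 h2
    exact h1.trans_le h2
  · obtain ⟨m, hm⟩ := (hu.eventually_lt_const ha).exists
    obtain ⟨v, hv, hv'⟩ := hx2 m
    filter_upwards [hv.eventually_lt_const hm, hv'] with N h1 h2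
    exact h2.trans_lt h1

end AlmostSure

/-! ### Measurability of the estimator and passage to the product measure -/

section Dependence

variable {A : Type*} {x x' y y' : ℕ → A} {N : ℕ}

theorem wordLength_congr (hx : ∀ j < N, x j = x' j) (hy : ∀ j < N, y j = y' j) (i : ℕ) :
    wordLength x y N i = wordLength x' y' N i := by
  classical
  have key : ∀ l ≤ N - i, (OccursIn x y N i l ↔ OccursIn x' y' N i l) := fun l hl => by
    refine exists_congr fun r => and_congr_right fun hr => forall₂_congr fun j hj => ?_
    rw [hx _ (by omega), hy _ (by omega)]
  unfold wordLength
  congr 1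
  rw [Nat.findGreatest_eq_iff]
  refine ⟨Nat.findGreatest_le _, fun h => ?_, fun n hn hn' h => ?_⟩
  · exact (key _ (Nat.findGreatest_le _)).2 (Nat.findGreatest_of_ne_zero rfl h)
  · exact Nat.findGreatest_is_greatest hn hn' ((key _ hn').1 h)

theorem parsingCount_congr (hx : ∀ j < N, x j = x' j) (hy : ∀ j < N, y j = y' j) :
    parsingCount y x N = parsingCount y' x' N := by
  have key (j : ℕ) : parsedLength x y N j = parsedLength x' y' N j := by
    induction j with
    | zero => rfl
    | succ j ih => rw [parsedLength, parsedLength, ih, wordLength_congr hx hy]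
  simp only [parsingCount, key]

variable [MeasurableSpace A]

theorem measurable_word (i n : ℕ) : Measurable fun y : ℕ → A => word y i n :=
  measurable_pi_iff.2 fun j => measurable_pi_apply (i + j)

variable [MeasurableSingletonClass A]

/-- The estimator depends only on the first `N` letters of each sequence, so it factors through a
finite set; the letters used to extend words to sequences are irrelevant. -/
theorem measurable_zmEstimator [Finite A] [Nonempty A] (N : ℕ) :
    Measurable fun p : (ℕ → A) × (ℕ → A) => zmEstimator p.2 p.1 N := by
  set ext : (Fin N → A) → ℕ → A := fun a k => if h : k < N then a ⟨k, h⟩ else Classical.arbitrary A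
  have hext (y : ℕ → A) : ∀ j < N, y j = ext (word y 0 N) j := fun j hj => by
    simp [ext, word, hj]
  have : (fun p : (ℕ → A) × (ℕ → A) => zmEstimator p.2 p.1 N) =
      (fun q : (Fin N → A) × (Fin N → A) => zmEstimator (ext q.2) (ext q.1) N) ∘
        fun p => (word p.1 0 N, word p.2 0 N) := by
    funext p
    simp only [Function.comp, zmEstimator]
    rw [parsingCount_congr (hext p.1) (hext p.2)]
  rw [this]
  exact Measurable.of_discrete.comp
    (((measurable_word 0 N).comp measurable_fst).prodMk ((measurable_word 0 N).comp measurable_snd))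

end Dependence

theorem ae_prod_of_ae_ae_swap {α β : Type*} [MeasurableSpace α] [MeasurableSpace β] {μ : Measure α}
    {ν : Measure β} [SFinite μ] [SFinite ν] {p : α × β → Prop} (hp : MeasurableSet {z | p z})
    (h : ∀ᵐ y ∂ν, ∀ᵐ x ∂μ, p (x, y)) : ∀ᵐ z ∂μ.prod ν, p z := by
  rw [← Measure.prod_swap, ae_map_iff measurable_swap.aemeasurable hp]
  exact (Measure.ae_prod_iff_ae_ae (measurable_swap hp)).2 h

/-! ### The cost rate and the cross entropy -/

/-- A sequence which is close to each `a m` up to a vanishing error converges, and so does `a`. -/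
theorem exists_tendsto_of_abs_sub_le {u a b : ℕ → ℝ} (hb : Tendsto b atTop (𝓝 0))
    (h : ∀ m ≥ 1, ∀ η > 0, ∀ᶠ n in atTop, |u n - a m| ≤ b m + η) :
    ∃ l, Tendsto u atTop (𝓝 l) ∧ Tendsto a atTop (𝓝 l) := by
  have hcau : CauchySeq u := by
    rw [Metric.cauchySeq_iff']
    intro ε hε
    obtain ⟨m, hm, hm1⟩ := ((hb.eventually_lt_const (show 0 < ε / 8 by positivity)).and
      (eventually_ge_atTop 1)).exists
    obtain ⟨N, hN⟩ := eventually_atTop.1 (h m hm1 (ε / 8) (by positivity))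
    refine ⟨N, fun n hn => ?_⟩
    have h1 := abs_le.1 (hN n hn)
    have h2 := abs_le.1 (hN N le_rfl)
    rw [Real.dist_eq, abs_lt]
    constructor <;> linarith [h1.1, h1.2, h2.1, h2.2]
  obtain ⟨l, hl⟩ := cauchySeq_tendsto_of_complete hcau
  refine ⟨l, hl, ?_⟩
  rw [tendsto_iff_dist_tendsto_zero]
  refine squeeze_zero' (Eventually.of_forall fun _ => dist_nonneg) ?_ hb
  filter_upwards [eventually_ge_atTop 1] with m hm
  refine le_of_forall_pos_le_add fun η hη => ?_
  rw [dist_comm, Real.dist_eq]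
  exact le_of_tendsto ((hl.sub_const (a m)).abs) (h m hm η hη)

section CrossEntropy

variable {A : Type*} [Fintype A] [MeasurableSpace A] [MeasurableSingletonClass A]
  {P Q : Measure (ℕ → A)} [IsProbabilityMeasure P] [IsProbabilityMeasure Q]

theorem measurable_cost (P : Measure (ℕ → A)) (m : ℕ) : Measurable fun y => cost P y 0 m :=
  (Measurable.of_discrete (f := fun a : Fin m → A => -Real.log (P.real (cyl a)))).comp
    (measurable_word 0 m)

omit [Fintype A] [MeasurableSingletonClass A] [IsProbabilityMeasure P] in
theorem birkhoffSum_cost (m n : ℕ) (y : ℕ → A) :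
    birkhoffSum shift (fun y => cost P y 0 m) n y = ∑ i ∈ Finset.range n, cost P y i m :=
  Finset.sum_congr rfl fun i _ => by simp only [cost, word_iterate_shift, add_zero]

omit [IsProbabilityMeasure Q] in
theorem ae_forall_cyl_word_pos (hQ : MeasurePreserving shift Q Q)
    (hPQ : ∀ (n : ℕ) (a : Fin n → A), P (cyl a) = 0 → Q (cyl a) = 0) :
    ∀ᵐ y ∂Q, ∀ i n, 0 < P.real (cyl (word y i n)) := by
  refine ae_all_iff.2 fun i => ae_all_iff.2 fun n => ?_
  have : ∀ᵐ y ∂Q, ∀ a : Fin n → A, P (cyl a) = 0 → shift^[i] y ∉ cyl a := by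
    refine ae_all_iff.2 fun a => ?_
    by_cases ha : P (cyl a) = 0
    · have h0 : Q (shift^[i] ⁻¹' cyl a) = 0 := by
        rw [(hQ.iterate i).measure_preimage (measurableSet_cyl a).nullMeasurableSet]
        exact hPQ n a ha
      filter_upwards [measure_eq_zero_iff_ae_notMem.1 h0] with y hy _ using hy
    · exact Eventually.of_forall fun y h => absurd h ha
  filter_upwards [this] with y hy
  refine ENNReal.toReal_pos (fun h0 => hy _ h0 (iterate_shift_mem_cyl_word.2 fun _ _ => rfl))
    (measure_ne_top _ _)

omit [IsProbabilityMeasure P] in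
theorem integral_cost (n : ℕ) : ∫ y, cost P y 0 n ∂Q =
    ∑ a : Fin n → A, Q.real (cyl a) * -Real.log (P.real (cyl a)) := by
  have h1 : ∫ y, cost P y 0 n ∂Q =
      ∫ a, -Real.log (P.real (cyl a)) ∂(Q.map fun y => word y 0 n) := by
    rw [integral_map (measurable_word 0 n).aemeasurable
      Measurable.of_discrete.aestronglyMeasurable]
    rfl
  have : IsProbabilityMeasure (Q.map fun y => word y 0 n) :=
    Measure.isProbabilityMeasure_map (measurable_word 0 n).aemeasurable
  rw [h1, integral_fintype (Integrable.of_finite)]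
  refine Finset.sum_congr rfl fun a _ => ?_
  rw [smul_eq_mul, map_measureReal_apply (measurable_word 0 n) (measurableSet_singleton a)]
  congr 2
  ext y
  rw [Set.mem_preimage, Set.mem_singleton_iff, funext_iff]
  simp [word, cyl]

theorem crossEntropySeq_eq_ofReal
    (hPQ : ∀ (n : ℕ) (a : Fin n → A), P (cyl a) = 0 → Q (cyl a) = 0) {n : ℕ} (hn : 1 ≤ n) :
    crossEntropySeq Q P n = ENNReal.ofReal ((∫ y, cost P y 0 n ∂Q) / n) := by
  have hn0 : (0 : ℝ) < n := by exact_mod_cast hn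
  have hneg (a : Fin n → A) : 0 ≤ -Real.log (P.real (cyl a)) :=
    neg_nonneg.2 (Real.log_nonpos measureReal_nonneg measureReal_le_one)
  rw [crossEntropySeq, ENNReal.ofReal_div_of_pos hn0, ENNReal.ofReal_natCast, integral_cost,
    ENNReal.ofReal_sum_of_nonneg fun a _ => mul_nonneg measureReal_nonneg (hneg a)]
  congr 1
  refine Finset.sum_congr rfl fun a _ => ?_
  by_cases ha : P (cyl a) = 0
  · have hQa := hPQ n a ha
    simp [hQa, measureReal_def]
  · have hpos : 0 < P.real (cyl a) := ENNReal.toReal_pos ha (measure_ne_top _ _)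
    rw [ENNReal.ofReal_mul measureReal_nonneg, ofReal_measureReal, ← ofReal_measureReal (μ := P),
      ENNReal.log_ofReal_of_pos hpos, ← EReal.coe_neg, EReal.toENNReal_of_ne_top (EReal.coe_ne_top _),
      EReal.toReal_coe]

/-- If the words of positive `Q`-probability have positive `P`-probability, the cost rate exists
almost surely and is the cross entropy. -/
theorem exists_isCrossEntropy_and_ae_tendsto_cost (hQ : Ergodic shift Q)
    (hPQ : ∀ (n : ℕ) (a : Fin n → A), P (cyl a) = 0 → Q (cyl a) = 0) {k : ℕ → ℝ} {C : ℝ}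
    (hk : k =o[atTop] fun n : ℕ => (n : ℝ))
    (hAA : ∀ y : ℕ → A, (∀ i n, 0 < P.real (cyl (word y i n))) →
      AlmostAdditive (cost P y) k C) :
    ∃ h : ℝ, IsCrossEntropy Q P (ENNReal.ofReal h) ∧
      ∀ᵐ y ∂Q, Tendsto (fun n : ℕ => cost P y 0 n / n) atTop (𝓝 h) := by
  have hbirk : ∀ᵐ y ∂Q, ∀ m : ℕ, Tendsto (fun n : ℕ => (∑ i ∈ Finset.range n, cost P y i m) / n)
      atTop (𝓝 (∫ y, cost P y 0 m ∂Q)) := by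
    refine ae_all_iff.2 fun m => ?_
    have hfin : (Set.range fun a : Fin m → A => |(-Real.log (P.real (cyl a)))|).Finite :=
      Set.finite_range _
    obtain ⟨c, hc⟩ := hfin.bddAbove
    filter_upwards [ae_tendsto_birkhoffSum_div hQ (measurable_cost P m) (C := c)
      fun y => hc ⟨word y 0 m, rfl⟩] with y hy
    simpa only [birkhoffSum_cost] using hy
  -- The limit is shared with the mean costs, which do not depend on `y`; hence it is the same for
  -- almost every `y`.
  have hy : ∀ᵐ y ∂Q, ∃ l, Tendsto (fun n : ℕ => cost P y 0 n / n) atTop (𝓝 l) ∧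
      Tendsto (fun m : ℕ => (∫ y, cost P y 0 m ∂Q) / m) atTop (𝓝 l) := by
    filter_upwards [hbirk, ae_forall_cyl_word_pos hQ.toMeasurePreserving hPQ] with y hy hpos
    have h := hAA y hpos
    refine exists_tendsto_of_abs_sub_le (b := fun m => k m / m) hk.tendsto_div_nhds_zero
      fun m hm η hη => ?_
    have hm0 : (0 : ℝ) < m := by exact_mod_cast hm
    have herr : Tendsto (fun n : ℕ => |(∑ i ∈ Finset.range n, cost P y i m) / n / m -
        (∫ y, cost P y 0 m ∂Q) / m| + 2 * m * C / n) atTop (𝓝 0) := by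
      have e1 := (((hy m).div_const (m : ℝ)).sub_const ((∫ y, cost P y 0 m ∂Q) / m)).abs
      have e2 := (tendsto_const_nhds (x := 2 * m * C)).div_atTop
        (tendsto_natCast_atTop_atTop (R := ℝ))
      simpa using e1.add e2
    filter_upwards [herr.eventually_lt_const hη, eventually_ge_atTop 1] with n hn hn1
    have hn0 : (0 : ℝ) < n := by exact_mod_cast hn1
    have h1 := h.abs_mul_sub_sum_le hm n
    have h2 : |cost P y 0 n / n - (∑ i ∈ Finset.range n, cost P y i m) / n / m| ≤
        k m / m + 2 * m * C / n := by
      have e1 : cost P y 0 n / n - (∑ i ∈ Finset.range n, cost P y i m) / n / m =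
          (m * cost P y 0 n - ∑ i ∈ Finset.range n, cost P y i m) / (n * m) := by
        field_simp
      have e2 : k m / m + 2 * m * C / n = (n * k m + 2 * m * (m * C)) / (n * m) := by
        field_simp
      rw [e1, e2, abs_div, abs_of_pos (mul_pos hn0 hm0)]
      gcongr
    have h3 := abs_sub_le (cost P y 0 n / n) ((∑ i ∈ Finset.range n, cost P y i m) / n / m)
      ((∫ y, cost P y 0 m ∂Q) / m)
    linarith
  obtain ⟨y₀, h, -, hlim⟩ := hy.exists
  refine ⟨h, ?_, ?_⟩
  · refine ((ENNReal.continuous_ofReal.tendsto h).comp hlim).congr' ?_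
    filter_upwards [eventually_ge_atTop 1] with n hn
    exact (crossEntropySeq_eq_ofReal hPQ hn).symm
  · filter_upwards [hy] with y ⟨l, hl, hl'⟩
    rwa [tendsto_nhds_unique hlim hl']

omit [MeasurableSingletonClass A] [IsProbabilityMeasure P] [IsProbabilityMeasure Q] in
/-- If some word has positive `Q`-probability, but `P`-probability zero, the cross entropy is
infinite. -/
theorem isCrossEntropy_top {m : ℕ} {a : Fin m → A} (hPa : P (cyl a) = 0) (hQa : Q (cyl a) ≠ 0) :
    IsCrossEntropy Q P ⊤ := by
  refine tendsto_const_nhds.congr' ?_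
  filter_upwards [eventually_ge_atTop m] with n hn
  obtain ⟨b, hPb, hQb⟩ : ∃ b : Fin n → A, P (cyl b) = 0 ∧ Q (cyl b) ≠ 0 := by
    by_contra! hcon
    -- The cylinder of `a` is covered by those of its prolongations to length `n`, all of P-measure
    -- zero; if they all had Q-measure zero, so would `a`.
    refine hQa (measure_mono_null (t := ⋃ b ∈ {b : Fin n → A | P (cyl b) = 0}, cyl b) ?_
      ((measure_biUnion_null_iff (Set.to_countable _)).2 fun b hb => hcon b hb))
    intro y hy
    refine Set.mem_biUnion (x := word y 0 n) (measure_mono_null ?_ hPa)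
      (mem_cyl_word.2 fun j _ => by rw [zero_add])
    intro x hx i
    rw [mem_cyl_word.1 hx i (i.2.trans_le hn), zero_add]
    exact hy i
  have htop : ∑ a : Fin n → A, Q (cyl a) * (-(ENNReal.log (P (cyl a)))).toENNReal = ⊤ := by
    refine ENNReal.sum_eq_top.2 ⟨b, Finset.mem_univ _, ?_⟩
    rw [hPb, ENNReal.log_zero, EReal.neg_bot, EReal.toENNReal_top, ENNReal.mul_top hQb]
  rw [crossEntropySeq, htop, ENNReal.top_div_of_ne_top (ENNReal.natCast_ne_top n)]

omit [Fintype A] in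
-- The word `a` is absent from `x` but has frequency `q` in `y`, and the end of a parsed word serves
-- at most `m` of its occurrences. So the number of parsed words is at least about q N / m.
theorem ae_ae_tendsto_zmEstimator_atTop (hP : MeasurePreserving shift P P) (hQ : Ergodic shift Q)
    {m : ℕ} {a : Fin m → A} (hPa : P (cyl a) = 0) (hQa : Q (cyl a) ≠ 0) :
    ∀ᵐ y ∂Q, ∀ᵐ x ∂P, Tendsto (zmEstimator y x) atTop atTop := by
  classical
  have hm : 1 ≤ m := by
    by_contra hm
    obtain rfl : m = 0 := by omega
    have : cyl a = Set.univ := by ext x; simp [cyl]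
    simp [this] at hPa
  have hm0 : (0 : ℝ) < m := by exact_mod_cast hm
  have hx : ∀ᵐ x ∂P, ∀ i, shift^[i] x ∉ cyl a := by
    refine ae_all_iff.2 fun i => ?_
    have h0 : P (shift^[i] ⁻¹' cyl a) = 0 := by
      rw [(hP.iterate i).measure_preimage (measurableSet_cyl a).nullMeasurableSet, hPa]
    exact measure_eq_zero_iff_ae_notMem.1 h0
  set q := Q.real (cyl a) with hq
  have hq0 : 0 < q := ENNReal.toReal_pos hQa (measure_ne_top _ _)
  have hbirk := ae_tendsto_birkhoffSum_div hQ (g := (cyl a).indicator fun _ => (1 : ℝ))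
    (measurable_const.indicator (measurableSet_cyl a)) (C := 1) fun y => by
      by_cases hy : y ∈ cyl a <;> simp [hy]
  have hint : ∫ y, (cyl a).indicator (fun _ => (1 : ℝ)) y ∂Q = q := by
    rw [integral_indicator (measurableSet_cyl a)]
    simp [hq]
  rw [hint] at hbirk
  filter_upwards [hbirk] with y hy
  filter_upwards [hx] with x hx
  have hocc (N i : ℕ) (hi : shift^[i] y ∈ cyl a) : ¬OccursIn x y N i m := by
    rintro ⟨r, -, hr⟩
    refine hx r fun j => ?_
    rw [iterate_shift_apply, hr j j.2, ← iterate_shift_apply i y]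
    exact hi j
  have htop : Tendsto (fun N : ℕ => q / (4 * m) * Real.log N) atTop atTop :=
    tendsto_log_natCast.const_mul_atTop (by positivity)
  refine tendsto_atTop_mono' _ ?_ htop
  have hlarge := (tendsto_sub_atTop_nat (m - 1)).eventually
    (hy.eventually_const_lt (show q / 2 < q by linarith))
  filter_upwards [hlarge, eventually_ge_atTop (2 * m)] with N hN hNm
  -- This is the number of windows of length `m` in the first `N` letters. The 4 in the bound is 2
  -- for N ≤ 2n times 2 for the frequency q/2.
  set n := N - (m - 1) with hn
  have hn0 : (0 : ℝ) < n := by exact_mod_cast (show 0 < n by omega)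
  have hN0 : (0 : ℝ) < N := by exact_mod_cast (show 0 < N by omega)
  have hcard := card_le_mul_parsingCount (x := x) (y := y) (N := N) hm
    ((Finset.range n).filter fun i => shift^[i] y ∈ cyl a) fun i hi => by
      simp only [Finset.mem_filter, Finset.mem_range] at hi
      exact ⟨by omega, hocc N i hi.2⟩
  have hsum : birkhoffSum shift ((cyl a).indicator fun _ => (1 : ℝ)) n y =
      (((Finset.range n).filter fun i => shift^[i] y ∈ cyl a).card : ℝ) := by
    rw [Finset.card_filter, birkhoffSum]
    push_cast
    exact Finset.sum_congr rfl fun i _ => by simp [Set.indicator_apply]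
  rw [hsum, lt_div_iff₀ hn0] at hN
  have h1 : (((Finset.range n).filter fun i => shift^[i] y ∈ cyl a).card : ℝ) ≤
      m * parsingCount y x N := by exact_mod_cast hcard
  have h2 : (N : ℝ) ≤ 2 * n := by exact_mod_cast (show N ≤ 2 * n by omega)
  have h3 : q * N ≤ 4 * m * parsingCount y x N := by nlinarith
  have hlog := Real.log_natCast_nonneg N
  rw [zmEstimator, div_mul_eq_mul_div, div_le_div_iff₀ (by positivity) hN0]
  calc q * Real.log N * N = q * N * Real.log N := by ring
    _ ≤ 4 * m * parsingCount y x N * Real.log N := by gcongr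
    _ = _ := by ring

end CrossEntropy

end ZivMerhav

/-! ### The theorem, by cases on whether a word of positive Q-probability has P-probability zero -/

theorem theorem1 {A : Type*} [Fintype A] [MeasurableSpace A] [MeasurableSingletonClass A]
    (P Q : Measure (ℕ → A)) [IsProbabilityMeasure P] [IsProbabilityMeasure Q]
    (hP : MeasurePreserving ZivMerhav.shift P P)
    (hPID : ZivMerhav.ImmediatelyDecoupled P)
    (hPFE : ZivMerhav.FastDecay P)
    (hPKB : ZivMerhav.KontoyiannisBound P)
    (hQ : Ergodic ZivMerhav.shift Q)
    (hQID : ZivMerhav.ImmediatelyDecoupled Q)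
    (hQFE : ZivMerhav.FastDecay Q) :
    ∃ h : ℝ≥0∞, ZivMerhav.IsCrossEntropy Q P h ∧
      ∀ᵐ p : (ℕ → A) × (ℕ → A) ∂(P.prod Q),
        Tendsto (fun N : ℕ => ENNReal.ofReal (ZivMerhav.zmEstimator p.2 p.1 N)) atTop (𝓝 h) := by
  have hA : Nonempty A := (P.nonempty_of_neZero).map fun x => x 0
  have hmeas (h : ℝ≥0∞) : MeasurableSet {p : (ℕ → A) × (ℕ → A) | Tendsto
      (fun N : ℕ => ENNReal.ofReal (ZivMerhav.zmEstimator p.2 p.1 N)) atTop (𝓝 h)} :=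
    measurableSet_tendsto _ fun N => (ZivMerhav.measurable_zmEstimator N).ennreal_ofReal
  by_cases hPQ : ∀ (n : ℕ) (a : Fin n → A), P (ZivMerhav.cyl a) = 0 → Q (ZivMerhav.cyl a) = 0
  · obtain ⟨k, C, hk, hAA⟩ := ZivMerhav.exists_almostAdditive hP hPID
    obtain ⟨γ, n₀, hγ, hF⟩ := ZivMerhav.exists_mul_le_cost hPFE
    obtain ⟨h, hh, hlim⟩ :=
      ZivMerhav.exists_isCrossEntropy_and_ae_tendsto_cost hQ hPQ hk hAA
    refine ⟨ENNReal.ofReal h, hh, ZivMerhav.ae_prod_of_ae_ae_swap (hmeas _) ?_⟩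
    filter_upwards [hlim, ZivMerhav.ae_forall_cyl_word_pos hQ.toMeasurePreserving hPQ]
      with y hy hpos
    filter_upwards [ZivMerhav.ae_tendsto_zmEstimator hP hpos hPKB (hAA y hpos) hk hγ (hF y hpos) hy]
      with x hx
    exact (ENNReal.continuous_ofReal.tendsto h).comp hx
  · push Not at hPQ
    obtain ⟨m, a, hPa, hQa⟩ := hPQ
    refine ⟨⊤, ZivMerhav.isCrossEntropy_top hPa hQa,
      ZivMerhav.ae_prod_of_ae_ae_swap (hmeas _) ?_⟩
    filter_upwards [ZivMerhav.ae_ae_tendsto_zmEstimator_atTop hP hQ hPa hQa] with y hy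
    filter_upwards [hy] with x hx
    exact ENNReal.tendsto_ofReal_atTop.comp hx
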